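/- Fix a set $\Sigma_V$ of basic types. Atomic types are the basic types and the types $L \multimap L'$, where $L, L'$ are finite lists of atomic types; a list of atomic types stands for the (strict) tensor product of its entries, $L :: L'$ is concatenation, and the empty list is the unit. Fix a set of operations, each with a list of input types and a list of output types. Hierarchical string diagrams $S : A \to C$ between lists of atomic types are the terms built from identities $\mathrm{id}_A$, symmetries $\gamma_{A,C} : A :: C \to C :: A$, the operations, contraction $A \to A :: A$, weakening $A \to [\,]$ and evaluation $[X \multimap Y] :: X \to Y$ (for all lists of types $A, C, X, Y$) by sequential composition, tensor product, and abstraction, which turns $f : \Gamma :: A \to C$ into a diagram $\Gamma \to [A \multimap C]$. Write $S =_{SMC} S'$ for the least congruence (also under abstraction) that contains the axioms of strict symmetric monoidal categories. A hierarchical hypergraph consists of finite sets $V, E$ of vertices and edges, source and target functions $s, t : E \to V^*$, a label $\ell_V(v)$ for every vertex, here an atomic type, a label $\ell_E(e)$ for every edge, here an operation, a contraction, a weakening, an evaluation, or $\bot$ (unlabelled), and parent functions $p_V : V \to E + \{\bot\}$, $p_E : E \to E + \{\bot\}$, such that an edge has the same parent as all its sources and targets, and repeatedly taking parents of an edge ends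 in $\bot$. The vertices and edges with parent $p \in E + \{\bot\}$ form the level $p$. A vertex is an input vertex if it is never a target, and an output vertex if it is never a source. A hypernet is a hierarchical hypergraph without directed cycles, in which every vertex occurs at most once as a source and at most once as a target (over all edges, with multiplicity), labelled edges are the parent of no vertex and no edge, and the input vertices and the output vertices of each level are totally ordered. It is well-typed if the types of the sources and targets of every labelled edge are the input and output types of its label, and for every unlabelled edge $e$, if $L_i$ and $L_o$ are the lists of types of the ordered inputs and outputs of level $e$, there is a list $L_a$ such that the sources of $e$ have types $L$ with $L :: L_a = L_i$ and $e$ has exactly one target, of type $L_a \multimap L_o$. Hypernets are considered up to isomorphism: bijections of vertices and of edges which preserve sources, targets, labels, parents and all interface orders. The interpretation $⟦S⟧$ is defined inductively: identities and symmetries are isolated vertices with the corresponding input and output orders; an operation, contraction, weakening or evaluation is a single edge with that label; the sequential composite identifies the $i$-th outermost output of the first hypernet with the $i$-th outermost input of the second; the tensor product is the disjoint union with concatenated outermost interfaces; the abstraction of $f : \Gamma :: A \to C$ is one outermost unlabelled edge, with new sources of types $\Gamma$ and a new target of type $A \multimap C$, which contains $⟦f⟧$. Theorem (Hierarchical Definability).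 1. For every well-typed hypernet $H$ there is a hierarchical string diagram $S$ with $⟦S⟧ \cong H$, whose input and output types are those of the outermost interfaces of $H$; and every hierarchical string diagram $S'$ with $⟦S'⟧ \cong H$ satisfies $S =_{SMC} S'$. 2. Hypernets are a sound and complete representation of hierarchical string diagrams: for every $S : A \to C$, $⟦S⟧$ is a well-typed hypernet with outermost input types $A$ and output types $C$, and for any two hierarchical string diagrams $S, S'$ one has $S =_{SMC} S'$ if and only if $⟦S⟧ \cong ⟦S'⟧$. -/

import Mathlib

universe u v

namespace HSD

/-- Atomic types generated from basic types: a basic type, or `L ⊸ L'` for objects `L`, `L'`.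
Since the monoidal structure is strict, an object is a list of atomic types, the tensor product is
concatenation, and the unit is the empty list. -/
inductive Ty (B : Type u) : Type u
  | base : B → Ty B
  | lolly : List (Ty B) → List (Ty B) → Ty B

/-- Objects: lists of atomic types. -/
abbrev Obj (B : Type u) : Type u := List (Ty B)

/-- A set of primitive operations over the basic types `B`, each with its input and output types. -/
structure Signature (B : Type u) : Type (max u (v + 1)) where
  Op : Type v
  dom : Op → Obj B
  cod : Op → Obj B

/-- The labels of hyperedges: primitive operations, contraction, weakening and evaluation. -/
inductive Label {B : Type u} (Sg : Signature.{u, v} B) : Type (max u v)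
  | op : Sg.Op → Label Sg
  | copy : Obj B → Label Sg
  | discard : Obj B → Label Sg
  | eval : Obj B → Obj B → Label Sg

/-- Input types of a label; evaluation is `(X ⊸ Y) ⊗ X → Y`. -/
def Label.dom {B : Type u} {Sg : Signature.{u, v} B} : Label Sg → Obj B
  | .op o => Sg.dom o
  | .copy A => A
  | .discard A => A
  | .eval X Y => [Ty.lolly X Y] ++ X

/-- Output types of a label. -/
def Label.cod {B : Type u} {Sg : Signature.{u, v} B} : Label Sg → Obj B
  | .op o => Sg.cod o
  | .copy A => A ++ A
  | .discard _ => []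
  | .eval _ Y => Y

/-- Hierarchical string diagrams, as typed terms: identities, primitive boxes, symmetries,
sequential and parallel composition, and abstraction (a bubble around a diagram). -/
inductive Diagram {B : Type u} (Sg : Signature.{u, v} B) : Obj B → Obj B → Type (max u v)
  | id (A : Obj B) : Diagram Sg A A
  | gen (l : Label Sg) : Diagram Sg l.dom l.cod
  | swap (A C : Obj B) : Diagram Sg (A ++ C) (C ++ A)
  | comp {A C D : Obj B} (f : Diagram Sg A C) (g : Diagram Sg C D) : Diagram Sg A D
  | tensor {A C A' C' : Obj B} (f : Diagram Sg A C) (g : Diagram Sg A' C') :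
      Diagram Sg (A ++ A') (C ++ C')
  | abs {Γ A C : Obj B} (f : Diagram Sg (Γ ++ A) C) : Diagram Sg Γ [Ty.lolly A C]

/-- Transport of a diagram along equalities between lists (such as associativity of `++`). -/
def Diagram.cast {B : Type u} {Sg : Signature.{u, v} B} {A A' C C' : Obj B}
    (hA : A = A') (hC : C = C') (f : Diagram Sg A C) : Diagram Sg A' C' :=
  hA ▸ hC ▸ f

/-- Equality of hierarchical string diagrams modulo the axioms of (strict) symmetric monoidal
categories: the least congruence, also inside abstractions, that contains these axioms.
The relation is written between diagrams with a priori different types, because the two sides of,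
for example, associativity of the tensor have types which are equal only up to associativity of
`++`; related diagrams always have equal types. -/
inductive SMCEq {B : Type u} {Sg : Signature.{u, v} B} :
    ∀ {A C A' C' : Obj B}, Diagram Sg A C → Diagram Sg A' C' → Prop
  | refl {A C : Obj B} (f : Diagram Sg A C) : SMCEq f f
  | symm {A C A' C' : Obj B} {f : Diagram Sg A C} {g : Diagram Sg A' C'} :
      SMCEq f g → SMCEq g f
  | trans {A C A' C' A'' C'' : Obj B} {f : Diagram Sg A C} {g : Diagram Sg A' C'}
      {h : Diagram Sg A'' C''} : SMCEq f g → SMCEq g h → SMCEq f h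
  | comp_congr {A C D A' C' D' : Obj B} {f : Diagram Sg A C} {g : Diagram Sg C D}
      {f' : Diagram Sg A' C'} {g' : Diagram Sg C' D'} :
      SMCEq f f' → SMCEq g g' → SMCEq (f.comp g) (f'.comp g')
  | tensor_congr {A₁ C₁ A₂ C₂ A₁' C₁' A₂' C₂' : Obj B}
      {f : Diagram Sg A₁ C₁} {g : Diagram Sg A₂ C₂}
      {f' : Diagram Sg A₁' C₁'} {g' : Diagram Sg A₂' C₂'} :
      SMCEq f f' → SMCEq g g' → SMCEq (f.tensor g) (f'.tensor g')
  | abs_congr {Γ A C : Obj B} {f f' : Diagram Sg (Γ ++ A) C} :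
      SMCEq f f' → SMCEq f.abs f'.abs
  | id_comp {A C : Obj B} (f : Diagram Sg A C) : SMCEq ((Diagram.id A).comp f) f
  | comp_id {A C : Obj B} (f : Diagram Sg A C) : SMCEq (f.comp (Diagram.id C)) f
  | comp_assoc {A C D F : Obj B} (f : Diagram Sg A C) (g : Diagram Sg C D) (h : Diagram Sg D F) :
      SMCEq ((f.comp g).comp h) (f.comp (g.comp h))
  | tensor_id (A C : Obj B) :
      SMCEq ((Diagram.id (Sg := Sg) A).tensor (Diagram.id C)) (Diagram.id (Sg := Sg) (A ++ C))
  | interchange {A C D A' C' D' : Obj B} (f : Diagram Sg A C) (g : Diagram Sg C D)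
      (f' : Diagram Sg A' C') (g' : Diagram Sg C' D') :
      SMCEq ((f.comp g).tensor (f'.comp g')) ((f.tensor f').comp (g.tensor g'))
  | tensor_assoc {A₁ C₁ A₂ C₂ A₃ C₃ : Obj B} (f : Diagram Sg A₁ C₁) (g : Diagram Sg A₂ C₂)
      (h : Diagram Sg A₃ C₃) : SMCEq ((f.tensor g).tensor h) (f.tensor (g.tensor h))
  | unit_tensor {A C : Obj B} (f : Diagram Sg A C) : SMCEq ((Diagram.id []).tensor f) f
  | tensor_unit {A C : Obj B} (f : Diagram Sg A C) : SMCEq (f.tensor (Diagram.id [])) f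
  | swap_natural {A C A' C' : Obj B} (f : Diagram Sg A C) (g : Diagram Sg A' C') :
      SMCEq ((f.tensor g).comp (Diagram.swap C C')) ((Diagram.swap A A').comp (g.tensor f))
  | swap_swap (A C : Obj B) :
      SMCEq ((Diagram.swap (Sg := Sg) A C).comp (Diagram.swap C A)) (Diagram.id (Sg := Sg) (A ++ C))
  | swap_unit (A : Obj B) : SMCEq (Diagram.swap (Sg := Sg) A []) (Diagram.id (Sg := Sg) A)
  | hexagon (A C D : Obj B) :
      SMCEq (Diagram.swap (Sg := Sg) A (C ++ D))
        (((Diagram.swap (Sg := Sg) A C).tensor (Diagram.id D)).comp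
          (((Diagram.id C).tensor (Diagram.swap A D)).cast (List.append_assoc C A D).symm rfl))

/-- The data of a hierarchical hypergraph with ordered interfaces: vertices, edges, sources,
targets, vertex labels, edge labels (`none` for an unlabelled edge), the parents of vertices and
edges (`none` for an outermost one), and, at each level of the hierarchy, a list of input vertices
and a list of output vertices. The level `none` is the outermost one, the level `some e` is the
inside of the edge `e`. The conditions on these data are the predicates below. -/
structure Net {B : Type u} (Sg : Signature.{u, v} B) : Type (max u v 1) where
  V : Type
  E : Type
  src : E → List V
  tgt : E → List V
  labV : V → Ty B
  labE : E → Option (Label Sg)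
  parV : V → Option E
  parE : E → Option E
  inputs : Option E → List V
  outputs : Option E → List V

namespace Net

variable {B : Type u} {Sg : Signature.{u, v} B}

/-- The conditions of a hierarchical hypergraph. -/
structure IsHierarchicalHypergraph (H : Net Sg) : Prop where
  finite_V : Finite H.V
  finite_E : Finite H.E
  par_src : ∀ e, ∀ v ∈ H.src e, H.parV v = H.parE e
  par_tgt : ∀ e, ∀ v ∈ H.tgt e, H.parV v = H.parE e
  par_acyclic : ∀ e, ∃ k, 1 ≤ k ∧ (fun o : Option H.E => o.bind H.parE)^[k] (some e) = none

/-- An input vertex never occurs as a target. -/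
def IsInput (H : Net Sg) (v : H.V) : Prop := ∀ e, v ∉ H.tgt e

/-- An output vertex never occurs as a source. -/
def IsOutput (H : Net Sg) (v : H.V) : Prop := ∀ e, v ∉ H.src e

/-- Some target of `e` is a source of `e'`. -/
def Precedes (H : Net Sg) (e e' : H.E) : Prop := ∃ v ∈ H.tgt e, v ∈ H.src e'

/-- The conditions of a hypernet. The lists `inputs p` and `outputs p` enumerate without repetition,
that is, totally order, the input and output vertices of level `p`. -/
structure IsHypernet (H : Net Sg) : Prop extends IsHierarchicalHypergraph H where
  acyclic : ∀ e, ¬ Relation.TransGen H.Precedes e e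
  src_nodup : ∀ e, (H.src e).Nodup
  src_unique : ∀ e e' v, v ∈ H.src e → v ∈ H.src e' → e = e'
  tgt_nodup : ∀ e, (H.tgt e).Nodup
  tgt_unique : ∀ e e' v, v ∈ H.tgt e → v ∈ H.tgt e' → e = e'
  inputs_nodup : ∀ p, (H.inputs p).Nodup
  mem_inputs : ∀ p v, v ∈ H.inputs p ↔ H.parV v = p ∧ H.IsInput v
  outputs_nodup : ∀ p, (H.outputs p).Nodup
  mem_outputs : ∀ p v, v ∈ H.outputs p ↔ H.parV v = p ∧ H.IsOutput v
  /- A labelled edge has an empty inner hypergraph. (An unlabelled edge may have one as well: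
  it is the abstraction of the empty diagram.) -/
  labelled_empty : ∀ e, H.labE e ≠ none → (∀ v, H.parV v ≠ some e) ∧ (∀ e', H.parE e' ≠ some e)

/-- Well-typedness of all labelled and unlabelled edges. -/
structure WellTyped (H : Net Sg) : Prop where
  labelled : ∀ e l, H.labE e = some l →
    (H.src e).map H.labV = l.dom ∧ (H.tgt e).map H.labV = l.cod
  unlabelled : ∀ e, H.labE e = none → ∃ La : Obj B,
    (H.src e).map H.labV ++ La = (H.inputs (some e)).map H.labV ∧
      (H.tgt e).map H.labV = [Ty.lolly La ((H.outputs (some e)).map H.labV)]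

/-- The types of the ordered outermost inputs. -/
def inTypes (H : Net Sg) : Obj B := (H.inputs none).map H.labV

/-- The types of the ordered outermost outputs. -/
def outTypes (H : Net Sg) : Obj B := (H.outputs none).map H.labV

/-- Isomorphisms, which preserve all the structure, including the order of all interfaces. -/
structure Iso (H K : Net Sg) where
  onV : H.V ≃ K.V
  onE : H.E ≃ K.E
  src_eq : ∀ e, K.src (onE e) = (H.src e).map onV
  tgt_eq : ∀ e, K.tgt (onE e) = (H.tgt e).map onV
  labV_eq : ∀ v, K.labV (onV v) = H.labV v
  labE_eq : ∀ e, K.labE (onE e) = H.labE e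
  parV_eq : ∀ v, K.parV (onV v) = (H.parV v).map onE
  parE_eq : ∀ e, K.parE (onE e) = (H.parE e).map onE
  inputs_eq : ∀ p : Option H.E, K.inputs (p.map onE) = (H.inputs p).map onV
  outputs_eq : ∀ p : Option H.E, K.outputs (p.map onE) = (H.outputs p).map onV

/-- Being isomorphic. -/
def Isomorphic (H K : Net Sg) : Prop := Nonempty (Iso H K)

/-- Identity: isolated vertices, with the same input and output order. -/
abbrev id (A : Obj B) : Net Sg where
  V := Fin A.length
  E := Empty
  src := Empty.elim
  tgt := Empty.elim
  labV := A.get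
  labE := Empty.elim
  parV _ := none
  parE := Empty.elim
  inputs _ := List.finRange A.length
  outputs _ := List.finRange A.length

/-- Symmetry: isolated vertices, with different input and output orders. -/
abbrev swap (A C : Obj B) : Net Sg where
  V := Fin A.length ⊕ Fin C.length
  E := Empty
  src := Empty.elim
  tgt := Empty.elim
  labV := Sum.elim A.get C.get
  labE := Empty.elim
  parV _ := none
  parE := Empty.elim
  inputs _ := (List.finRange A.length).map Sum.inl ++ (List.finRange C.length).map Sum.inr
  outputs _ := (List.finRange C.length).map Sum.inr ++ (List.finRange A.length).map Sum.inl

/-- A single labelled edge. -/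
abbrev gen (l : Label Sg) : Net Sg where
  V := Fin l.dom.length ⊕ Fin l.cod.length
  E := Unit
  src _ := (List.finRange l.dom.length).map Sum.inl
  tgt _ := (List.finRange l.cod.length).map Sum.inr
  labV := Sum.elim l.dom.get l.cod.get
  labE _ := some l
  parV _ := none
  parE _ := none
  inputs
    | none => (List.finRange l.dom.length).map Sum.inl
    | some _ => []
  outputs
    | none => (List.finRange l.cod.length).map Sum.inr
    | some _ => []

/-- Parallel composition: disjoint union, with the outermost interfaces concatenated. -/
abbrev tensor (H K : Net Sg) : Net Sg where
  V := H.V ⊕ K.V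
  E := H.E ⊕ K.E
  src := Sum.elim (fun e => (H.src e).map Sum.inl) (fun e => (K.src e).map Sum.inr)
  tgt := Sum.elim (fun e => (H.tgt e).map Sum.inl) (fun e => (K.tgt e).map Sum.inr)
  labV := Sum.elim H.labV K.labV
  labE := Sum.elim H.labE K.labE
  parV := Sum.elim (fun v => (H.parV v).map Sum.inl) (fun v => (K.parV v).map Sum.inr)
  parE := Sum.elim (fun e => (H.parE e).map Sum.inl) (fun e => (K.parE e).map Sum.inr)
  inputs
    | none => (H.inputs none).map Sum.inl ++ (K.inputs none).map Sum.inr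
    | some (Sum.inl e) => (H.inputs (some e)).map Sum.inl
    | some (Sum.inr e) => (K.inputs (some e)).map Sum.inr
  outputs
    | none => (H.outputs none).map Sum.inl ++ (K.outputs none).map Sum.inr
    | some (Sum.inl e) => (H.outputs (some e)).map Sum.inl
    | some (Sum.inr e) => (K.outputs (some e)).map Sum.inr

open Classical in
/-- If `v` is the `i`-th outermost input of `K`, the `i`-th outermost output of `H`, with which `v`
is to be identified; `none` for all other vertices `v` of `K`. -/
noncomputable def partner (H K : Net Sg) (v : K.V) : Option H.V :=
  ((K.inputs none).zip (H.outputs none)).lookup v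

/-- The vertices of the sequential composition: those of `H`, and those of `K` that are not
identified with a vertex of `H`. -/
abbrev CompV (H K : Net Sg) : Type := H.V ⊕ {v : K.V // partner H K v = none}

/-- The image of a vertex of `K` in the sequential composition. -/
noncomputable def glue (H K : Net Sg) (v : K.V) : CompV H K :=
  match h : partner H K v with
  | some w => Sum.inl w
  | none => Sum.inr ⟨v, h⟩

/-- Sequential composition: the disjoint union, in which the `i`-th outermost output of `H` is
identified with the `i`-th outermost input of `K`, for every `i`. -/
noncomputable abbrev comp (H K : Net Sg) : Net Sg where
  V := CompV H K
  E := H.E ⊕ K.E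
  src := Sum.elim (fun e => (H.src e).map Sum.inl) (fun e => (K.src e).map (glue H K))
  tgt := Sum.elim (fun e => (H.tgt e).map Sum.inl) (fun e => (K.tgt e).map (glue H K))
  labV := Sum.elim H.labV (fun v => K.labV v.1)
  labE := Sum.elim H.labE K.labE
  parV := Sum.elim (fun v => (H.parV v).map Sum.inl) (fun v => (K.parV v.1).map Sum.inr)
  parE := Sum.elim (fun e => (H.parE e).map Sum.inl) (fun e => (K.parE e).map Sum.inr)
  inputs
    | none => (H.inputs none).map Sum.inl
    | some (Sum.inl e) => (H.inputs (some e)).map Sum.inl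
    | some (Sum.inr e) => (K.inputs (some e)).map (glue H K)
  outputs
    | none => (K.outputs none).map (glue H K)
    | some (Sum.inl e) => (H.outputs (some e)).map Sum.inl
    | some (Sum.inr e) => (K.outputs (some e)).map (glue H K)

/-- Abstraction: one new outermost edge (written `none`), which is unlabelled, has new source
vertices of types `Γ` and one new target vertex of type `A ⊸ C`, and contains `H`. -/
abbrev abs (Γ A C : Obj B) (H : Net Sg) : Net Sg where
  V := (Fin Γ.length ⊕ Unit) ⊕ H.V
  E := Option H.E
  src
    | none => (List.finRange Γ.length).map (fun i => Sum.inl (Sum.inl i))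
    | some e => (H.src e).map Sum.inr
  tgt
    | none => [Sum.inl (Sum.inr ())]
    | some e => (H.tgt e).map Sum.inr
  labV := Sum.elim (Sum.elim Γ.get (fun _ => Ty.lolly A C)) H.labV
  labE
    | none => none
    | some e => H.labE e
  parV := Sum.elim (fun _ => none) (fun v => some (H.parV v))
  parE
    | none => none
    | some e => some (H.parE e)
  inputs
    | none => (List.finRange Γ.length).map (fun i => Sum.inl (Sum.inl i))
    | some p => (H.inputs p).map Sum.inr
  outputs
    | none => [Sum.inl (Sum.inr ())]
    | some p => (H.outputs p).map Sum.inr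

end Net

/-- The interpretation of a hierarchical string diagram as a hypernet. -/
noncomputable def Diagram.interp {B : Type u} {Sg : Signature.{u, v} B} :
    ∀ {A C : Obj B}, Diagram Sg A C → Net Sg
  | _, _, .id A => Net.id A
  | _, _, .gen l => Net.gen l
  | _, _, .swap A C => Net.swap A C
  | _, _, .comp f g => Net.comp f.interp g.interp
  | _, _, .tensor f g => Net.tensor f.interp g.interp
  | _, _, .abs (Γ := Γ) (A := A) (C := C) f => Net.abs Γ A C f.interp

end HSD

namespace HSD

variable {B : Type u} {Sg : Signature.{u, v} B}

/-! Everything passes through the relation `Diagram.Sat`: given wires `Γ`, `out` and edges `M` of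
one level of a net, it says that this part of the net can be decomposed as the term `f` prescribes,
going inside an edge at each abstraction. For a hypernet `H`, a diagram `S` satisfies
`S.interp.Isomorphic H` exactly when `S` has the shape of the whole outermost level of `H`
(`sat_of_isomorphic`, `isomorphic_of_sat`). One direction transports the shape that `S.interp` has
by construction. The other builds a homomorphism out of `S.interp` by the universal properties of
gluing and disjoint union, and checks that homomorphisms which are bijective level by level are
isomorphisms.

Soundness is then the invariance of shapes under the axioms, `SMCEq.sat_iff`.

For completeness, a diagram with a given shape is rewritten as a `Run`: its edges are performed one
at a time, with permutations of named wires in between. Coherence for symmetries (`perm_comp`,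
`perm_append`, `perm_swap`) makes these permutations depend only on the names of the wires, and
interchange lets independent neighbouring edges trade places (`exchange`). So the composite of a run
depends only on its set of edges and its interfaces, not on their order (`Run.unique`). Two diagrams
of the same shape are therefore equal as soon as they agree on single edges. A labelled edge
determines its generator; for an unlabelled edge one uses induction from the innermost edges
outwards (`IsAtomic.toMor_eq`).

For existence, the edges of a level are peeled off in a topological order (`hasShape_of_remaining`),
again from the inside to the outside (`hasShape_edge`). Well-typedness is what turns a shape found
inside an edge into an abstraction. -/

theorem SMCEq.types {A C A' C' : Obj B} {f : Diagram Sg A C} {g : Diagram Sg A' C'}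
    (h : SMCEq f g) : A = A' ∧ C = C' := by
  induction h <;> simp_all

theorem SMCEq.cast_left {A C A' C' : Obj B} (f : Diagram Sg A C) (hA : A = A') (hC : C = C') :
    SMCEq (f.cast hA hC) f := by
  subst hA hC
  exact .refl f

/-! ### Diagrams modulo the axioms, as a strict symmetric monoidal category without casts -/

variable (Sg) in
/-- Diagrams of arbitrary type, modulo the axioms of symmetric monoidal categories. -/
def morSetoid : Setoid (Σ A C : Obj B, Diagram Sg A C) where
  r f g := SMCEq f.2.2 g.2.2
  iseqv := ⟨fun _ => .refl _, .symm, .trans⟩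

variable (Sg) in
/-- The morphisms of the free strict symmetric monoidal category, of arbitrary type. -/
def Mor : Type (max u v) := Quotient (morSetoid Sg)

/-- The class of a diagram. -/
def Diagram.toMor {A C : Obj B} (f : Diagram Sg A C) : Mor Sg :=
  Quotient.mk (morSetoid Sg) ⟨A, C, f⟩

theorem Diagram.toMor_eq_iff {A C A' C' : Obj B} {f : Diagram Sg A C} {g : Diagram Sg A' C'} :
    f.toMor = g.toMor ↔ SMCEq f g :=
  Quotient.eq (r := morSetoid Sg)

namespace Mor

/-- The source of a morphism. -/
def dom : Mor Sg → Obj B :=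
  Quotient.lift (fun f => f.1) fun _ _ h => (SMCEq.types h).1

/-- The target of a morphism. -/
def cod : Mor Sg → Obj B :=
  Quotient.lift (fun f => f.2.1) fun _ _ h => (SMCEq.types h).2

@[simp] theorem dom_toMor {A C : Obj B} (f : Diagram Sg A C) : f.toMor.dom = A := rfl
@[simp] theorem cod_toMor {A C : Obj B} (f : Diagram Sg A C) : f.toMor.cod = C := rfl

theorem exists_rep (m : Mor Sg) : ∃ (A C : Obj B) (f : Diagram Sg A C), f.toMor = m := by
  induction m using Quotient.inductionOn with
  | h a => exact ⟨a.1, a.2.1, a.2.2, rfl⟩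

variable (Sg) in
/-- Identities. -/
def ident (A : Obj B) : Mor Sg := (Diagram.id A).toMor

variable (Sg) in
/-- Symmetries. -/
def sym (A C : Obj B) : Mor Sg := (Diagram.swap A C).toMor

open Classical in
/-- Composition; the first morphism if the types do not match. -/
noncomputable def comp : Mor Sg → Mor Sg → Mor Sg :=
  Quotient.lift₂
    (fun f g => if h : f.2.1 = g.1 then (f.2.2.comp (g.2.2.cast h.symm rfl)).toMor
      else f.2.2.toMor) <| by
    rintro ⟨A, C, f⟩ ⟨A', C', g⟩ ⟨A₁, C₁, f₁⟩ ⟨A₁', C₁', g₁⟩ hf hg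
    obtain ⟨rfl, rfl⟩ := SMCEq.types hf
    obtain ⟨rfl, rfl⟩ := SMCEq.types hg
    dsimp only
    split_ifs with h
    · subst h
      exact Diagram.toMor_eq_iff.2 (.comp_congr hf hg)
    · exact Diagram.toMor_eq_iff.2 hf

infixr:65 " ⨾ " => Mor.comp

theorem toMor_comp {A C D : Obj B} (f : Diagram Sg A C) (g : Diagram Sg C D) :
    (f.comp g).toMor = f.toMor ⨾ g.toMor :=
  (dif_pos (t := fun h : C = C => (f.comp (g.cast h.symm rfl)).toMor) rfl).symm

/-- The tensor product. -/
def tensor : Mor Sg → Mor Sg → Mor Sg :=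
  Quotient.map₂ (fun f g => ⟨_, _, f.2.2.tensor g.2.2⟩) fun _ _ h _ _ h' => .tensor_congr h h'

/-- The tensor product is strictly associative and unital. -/
instance : Monoid (Mor Sg) where
  mul := tensor
  one := ident Sg []
  mul_assoc f g h := by
    obtain ⟨_, _, f, rfl⟩ := f.exists_rep
    obtain ⟨_, _, g, rfl⟩ := g.exists_rep
    obtain ⟨_, _, h, rfl⟩ := h.exists_rep
    exact Diagram.toMor_eq_iff.2 (.tensor_assoc f g h)
  one_mul f := by
    obtain ⟨_, _, f, rfl⟩ := f.exists_rep
    exact Diagram.toMor_eq_iff.2 (.unit_tensor f)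
  mul_one f := by
    obtain ⟨_, _, f, rfl⟩ := f.exists_rep
    exact Diagram.toMor_eq_iff.2 (.tensor_unit f)

theorem toMor_tensor {A C A' C' : Obj B} (f : Diagram Sg A C) (g : Diagram Sg A' C') :
    (f.tensor g).toMor = f.toMor * g.toMor := rfl

theorem id_nil : ident Sg [] = 1 := rfl

@[simp] theorem dom_id (A : Obj B) : (ident Sg A).dom = A := rfl
@[simp] theorem cod_id (A : Obj B) : (ident Sg A).cod = A := rfl
@[simp] theorem dom_one : (1 : Mor Sg).dom = [] := rfl
@[simp] theorem cod_one : (1 : Mor Sg).cod = [] := rfl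
@[simp] theorem dom_swap (A C : Obj B) : (sym Sg A C).dom = A ++ C := rfl
@[simp] theorem cod_swap (A C : Obj B) : (sym Sg A C).cod = C ++ A := rfl

@[simp] theorem dom_mul (f g : Mor Sg) : (f * g).dom = f.dom ++ g.dom := by
  obtain ⟨_, _, f, rfl⟩ := f.exists_rep
  obtain ⟨_, _, g, rfl⟩ := g.exists_rep
  rfl

@[simp] theorem cod_mul (f g : Mor Sg) : (f * g).cod = f.cod ++ g.cod := by
  obtain ⟨_, _, f, rfl⟩ := f.exists_rep
  obtain ⟨_, _, g, rfl⟩ := g.exists_rep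
  rfl

-- No matching condition is needed, because the default value of a mismatched composite is its first
-- factor.
@[simp] theorem dom_comp (f g : Mor Sg) : (f ⨾ g).dom = f.dom := by
  obtain ⟨_, C, f, rfl⟩ := f.exists_rep
  obtain ⟨C', _, g, rfl⟩ := g.exists_rep
  by_cases h : C = C'
  · subst h
    rw [← toMor_comp]
    simp
  · exact congrArg dom (dif_neg (c := C = C') h)

@[simp] theorem cod_comp (f g : Mor Sg) (h : f.cod = g.dom) : (f ⨾ g).cod = g.cod := by
  obtain ⟨_, C, f, rfl⟩ := f.exists_rep
  obtain ⟨C', _, g, rfl⟩ := g.exists_rep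
  obtain rfl : C = C' := h
  rw [← toMor_comp]
  simp

theorem id_comp {A : Obj B} (f : Mor Sg) (h : f.dom = A) : ident Sg A ⨾ f = f := by
  subst h
  obtain ⟨_, _, f, rfl⟩ := f.exists_rep
  rw [ident, dom_toMor, ← toMor_comp]
  exact Diagram.toMor_eq_iff.2 (.id_comp f)

@[simp] theorem id_comp_id (A : Obj B) : ident Sg A ⨾ ident Sg A = ident Sg A :=
  id_comp _ rfl

theorem comp_id {A : Obj B} (f : Mor Sg) (h : f.cod = A) : f ⨾ ident Sg A = f := by
  subst h
  obtain ⟨_, _, f, rfl⟩ := f.exists_rep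
  rw [ident, cod_toMor, ← toMor_comp]
  exact Diagram.toMor_eq_iff.2 (.comp_id f)

theorem assoc (f g h : Mor Sg) (hfg : f.cod = g.dom) (hgh : g.cod = h.dom) :
    (f ⨾ g) ⨾ h = f ⨾ g ⨾ h := by
  obtain ⟨_, C, f, rfl⟩ := f.exists_rep
  obtain ⟨C', D, g, rfl⟩ := g.exists_rep
  obtain ⟨D', _, h, rfl⟩ := h.exists_rep
  obtain rfl : C = C' := hfg
  obtain rfl : D = D' := hgh
  simp only [← toMor_comp]
  exact Diagram.toMor_eq_iff.2 (.comp_assoc f g h)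

/-- An equation between composites, extended to the right. -/
theorem comp_congr_left {f g h : Mor Sg} (e : f ⨾ g = h) (k : Mor Sg) (hf : f.cod = g.dom)
    (hg : g.cod = k.dom) : f ⨾ g ⨾ k = h ⨾ k := by
  rw [← e, assoc _ _ _ hf hg]

theorem comp_congr_left₂ {f g f' g' : Mor Sg} (e : f ⨾ g = f' ⨾ g') (k : Mor Sg)
    (hf : f.cod = g.dom) (hf' : f'.cod = g'.dom) (hg : g.cod = k.dom) :
    f ⨾ g ⨾ k = f' ⨾ g' ⨾ k := by
  rw [comp_congr_left e k hf hg, assoc _ _ _ hf']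
  rw [← cod_comp _ _ hf', ← e, cod_comp _ _ hf, hg]

theorem id_mul_id (A C : Obj B) : ident Sg A * ident Sg C = ident Sg (A ++ C) :=
  Diagram.toMor_eq_iff.2 (.tensor_id A C)

theorem interchange (f g f' g' : Mor Sg) (h : f.cod = g.dom) (h' : f'.cod = g'.dom) :
    (f ⨾ g) * (f' ⨾ g') = f * f' ⨾ g * g' := by
  obtain ⟨_, C, f, rfl⟩ := f.exists_rep
  obtain ⟨C', D, g, rfl⟩ := g.exists_rep
  obtain rfl : C = C' := h
  obtain ⟨_, D, f', rfl⟩ := f'.exists_rep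
  obtain ⟨D', _, g', rfl⟩ := g'.exists_rep
  obtain rfl : D = D' := h'
  simp only [← toMor_comp, ← toMor_tensor]
  exact Diagram.toMor_eq_iff.2 (.interchange f g f' g')

theorem swap_natural (f g : Mor Sg) :
    f * g ⨾ sym Sg f.cod g.cod = sym Sg f.dom g.dom ⨾ g * f := by
  obtain ⟨A, C, f, rfl⟩ := f.exists_rep
  obtain ⟨A', C', g, rfl⟩ := g.exists_rep
  simp only [sym, dom_toMor, cod_toMor, ← toMor_comp, ← toMor_tensor]
  exact Diagram.toMor_eq_iff.2 (.swap_natural f g)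

theorem swap_swap (A C : Obj B) : sym Sg A C ⨾ sym Sg C A = ident Sg (A ++ C) := by
  rw [sym, sym, ← toMor_comp]
  exact Diagram.toMor_eq_iff.2 (.swap_swap A C)

theorem swap_nil (A : Obj B) : sym Sg A [] = ident Sg A :=
  Diagram.toMor_eq_iff.2 (.swap_unit A)

/-- The axioms only give the unit law on the other side; this one follows since the two symmetries
are mutually inverse. -/
theorem nil_swap (A : Obj B) : sym Sg [] A = ident Sg A := by
  have h := swap_swap (Sg := Sg) A []
  rw [swap_nil, id_comp _ (by simp)] at h
  simpa using h

theorem swap_append (A C D : Obj B) :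
    sym Sg A (C ++ D) = sym Sg A C * ident Sg D ⨾ ident Sg C * sym Sg A D := by
  refine (Diagram.toMor_eq_iff.2 (.hexagon A C D)).trans ?_
  rw [toMor_comp]
  congr 1
  exact Diagram.toMor_eq_iff.2 (SMCEq.cast_left _ _ _)

/-- Tensoring with identities is functorial. -/
theorem comp_mul_id (f g : Mor Sg) (A : Obj B) (h : f.cod = g.dom) :
    (f ⨾ g) * ident Sg A = f * ident Sg A ⨾ g * ident Sg A := by
  rw [← interchange _ _ _ _ h rfl, id_comp (A := A) (ident Sg A) rfl]

theorem id_mul_comp (f g : Mor Sg) (A : Obj B) (h : f.cod = g.dom) :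
    ident Sg A * (f ⨾ g) = ident Sg A * f ⨾ ident Sg A * g := by
  rw [← interchange _ _ _ _ rfl h, id_comp (A := A) (ident Sg A) rfl]

/-- The two ways of performing independent morphisms one after the other. -/
theorem mul_eq_left_right (f g : Mor Sg) :
    f * g = f * ident Sg g.dom ⨾ ident Sg f.cod * g := by
  rw [← interchange _ _ _ _ rfl rfl, id_comp _ rfl, comp_id _ rfl]

theorem mul_eq_right_left (f g : Mor Sg) :
    f * g = ident Sg f.dom * g ⨾ f * ident Sg g.cod := by
  rw [← interchange _ _ _ _ rfl rfl, id_comp _ rfl, comp_id _ rfl]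

/-- Only one hexagon is an axiom. The other holds because its right-hand side is, by the first
hexagon, a one-sided inverse of `sym Sg D (A ++ C)`, whose inverse is already known. -/
theorem append_swap (A C D : Obj B) :
    sym Sg (A ++ C) D = ident Sg A * sym Sg C D ⨾ sym Sg A D * ident Sg C := by
  have key : (ident Sg A * sym Sg C D ⨾ sym Sg A D * ident Sg C) ⨾ sym Sg D (A ++ C) =
      ident Sg (A ++ C ++ D) := by
    rw [swap_append, assoc _ _ _ (by simp) (by simp), ← assoc (sym Sg A D * _) _ _ (by simp)
      (by simp), ← comp_mul_id _ _ _ (by simp), swap_swap, id_mul_id, id_comp _ (by simp),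
      ← id_mul_comp _ _ _ (by simp), swap_swap, id_mul_id, List.append_assoc]
  calc sym Sg (A ++ C) D
      = ((ident Sg A * sym Sg C D ⨾ sym Sg A D * ident Sg C) ⨾ sym Sg D (A ++ C)) ⨾
          sym Sg (A ++ C) D := by rw [key, id_comp _ (by simp)]
    _ = _ := by
      rw [assoc _ _ _ (by simp) (by simp), swap_swap, comp_id _ (by simp)]

end Mor

/-! ### Coherence for permutations of named wires -/

namespace Mor

/-- The hexagon form of the braid relation, whiskered. -/
theorem braid (X Y Z : Obj B) :
    sym Sg Z Y * ident Sg X ⨾ ident Sg Y * sym Sg Z X ⨾ sym Sg Y X * ident Sg Z =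
      ident Sg Z * sym Sg Y X ⨾ sym Sg Z X * ident Sg Y ⨾ ident Sg X * sym Sg Z Y := by
  -- The hexagon merges the two crossings of `Z` into one crossing with a block; the claim becomes
  -- naturality of that crossing in `sym Sg Y X`.
  rw [← assoc _ _ _ (by simp) (by simp), ← swap_append, ← swap_append]
  exact (swap_natural (ident Sg Z) (sym Sg Y X)).symm

/-- This is the inductive step of `pull_comm`: `a`, `b` extract `Y` and then `X` from a list of
wires, `a'`, `b'` extract them in the other order, and `Z` is a wire added in front. The crossings
of `Z` slide past `b` and `b'`, after which only `braid` and the hypothesis `h` remain. -/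
theorem braid_whisker {X Y Z W Gx Gy : Obj B} {a b a' b' : Mor Sg}
    (ha₂ : a.cod = Y ++ Gy) (hb : b.dom = Gy) (hb₂ : b.cod = X ++ W)
    (ha₂' : a'.cod = X ++ Gx) (hb' : b'.dom = Gx) (hb₂' : b'.cod = Y ++ W)
    (h : a ⨾ ident Sg Y * b ⨾ sym Sg Y X * ident Sg W = a' ⨾ ident Sg X * b') :
    (ident Sg Z * a ⨾ sym Sg Z Y * ident Sg Gy) ⨾ ident Sg Y * (ident Sg Z * b ⨾ sym Sg Z X * ident Sg W) ⨾
        sym Sg Y X * ident Sg (Z ++ W) =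
      (ident Sg Z * a' ⨾ sym Sg Z X * ident Sg Gx) ⨾ ident Sg X * (ident Sg Z * b' ⨾ sym Sg Z Y * ident Sg W) := by
  have e1 : sym Sg Z Y * ident Sg Gy ⨾ ident Sg Y * (ident Sg Z * b) =
      ident Sg Z * (ident Sg Y * b) ⨾ sym Sg Z Y * ident Sg X * ident Sg W := by
    have := mul_eq_left_right (sym Sg Z Y) b
    rw [mul_eq_right_left] at this
    simpa [hb, hb₂, ← id_mul_id, mul_assoc] using this.symm
  have e2 : sym Sg Z X * ident Sg Gx ⨾ ident Sg X * (ident Sg Z * b') =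
      ident Sg Z * (ident Sg X * b') ⨾ sym Sg Z X * ident Sg Y * ident Sg W := by
    have := mul_eq_left_right (sym Sg Z X) b'
    rw [mul_eq_right_left] at this
    simpa [hb', hb₂', ← id_mul_id, mul_assoc] using this.symm
  have e3 := congrArg (· * ident Sg W) (braid (Sg := Sg) X Y Z)
  have e4 := congrArg (ident Sg Z * ·) h
  rw [comp_mul_id _ _ _ (by simp), comp_mul_id _ _ _ (by simp), comp_mul_id _ _ _ (by simp),
    comp_mul_id _ _ _ (by simp)] at e3
  rw [id_mul_comp _ _ _ (by simp [*]), id_mul_comp _ _ _ (by simp [*]),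
    id_mul_comp _ _ _ (by simp [*])] at e4
  calc _ = ident Sg Z * a ⨾ (sym Sg Z Y * ident Sg Gy ⨾ ident Sg Y * (ident Sg Z * b)) ⨾
          ident Sg Y * (sym Sg Z X * ident Sg W) ⨾ sym Sg Y X * ident Sg (Z ++ W) := by
        rw [id_mul_comp _ _ _ (by simp [*])]
        simp [assoc, ha₂, hb, hb₂]
    _ = (ident Sg Z * a ⨾ ident Sg Z * (ident Sg Y * b)) ⨾ (sym Sg Z Y * ident Sg X * ident Sg W ⨾
          ident Sg Y * sym Sg Z X * ident Sg W ⨾ sym Sg Y X * ident Sg Z * ident Sg W) := by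
        rw [e1, ← id_mul_id]
        simp [assoc, mul_assoc, ha₂, hb, hb₂]
    _ = (ident Sg Z * a ⨾ ident Sg Z * (ident Sg Y * b) ⨾ ident Sg Z * (sym Sg Y X * ident Sg W)) ⨾
          sym Sg Z X * ident Sg Y * ident Sg W ⨾ ident Sg X * sym Sg Z Y * ident Sg W := by
        rw [e3]
        simp [assoc, mul_assoc, ha₂, hb, hb₂]
    _ = ident Sg Z * a' ⨾ (ident Sg Z * (ident Sg X * b') ⨾ sym Sg Z X * ident Sg Y * ident Sg W) ⨾
          ident Sg X * sym Sg Z Y * ident Sg W := by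
        rw [e4]
        simp [assoc, mul_assoc, ha₂', hb', hb₂']
    _ = _ := by
        rw [← e2, id_mul_comp _ (sym Sg Z Y * _) _ (by simp [*])]
        simp [assoc, mul_assoc, ha₂', hb', hb₂']

end Mor

open Mor

section Perm

variable {V : Type*} [DecidableEq V] (lab : V → Ty B)

variable (Sg) in
/-- The permutation of wires that moves the wire named `x` to the front. -/
noncomputable def pull (x : V) : List V → Mor Sg
  -- A default value, reached only if `x` does not occur in the list.
  | [] => 1
  | y :: Γ => if y = x then ident Sg ((y :: Γ).map lab) else
      ident Sg [lab y] * pull x Γ ⨾ sym Sg [lab y] [lab x] * ident Sg ((Γ.erase x).map lab)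

variable (Sg) in
/-- The permutation of wires from the order `Γ` to the order `Δ` of their names. -/
noncomputable def perm : List V → List V → Mor Sg
  -- The first list is ignored here: `perm` is meaningful only between permutations of the same
  -- list.
  | _, [] => 1
  | Γ, x :: Δ => pull Sg lab x Γ ⨾ ident Sg [lab x] * perm (Γ.erase x) Δ

variable {lab}

@[simp] theorem pull_cons_self (x : V) (Γ : List V) :
    pull Sg lab x (x :: Γ) = ident Sg ((x :: Γ).map lab) := by
  simp [pull]

theorem pull_cons_ne {x y : V} (h : y ≠ x) (Γ : List V) : pull Sg lab x (y :: Γ) =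
    ident Sg [lab y] * pull Sg lab x Γ ⨾
      sym Sg [lab y] [lab x] * ident Sg ((Γ.erase x).map lab) := by
  simp [pull, h]

@[simp] theorem dom_pull (x : V) (Γ : List V) : (pull Sg lab x Γ).dom = Γ.map lab := by
  induction Γ with
  | nil => rfl
  | cons y Γ ih =>
    by_cases h : y = x
    · subst h; simp
    · simp [pull_cons_ne h, ih]

@[simp] theorem cod_pull {x : V} {Γ : List V} (hx : x ∈ Γ) :
    (pull Sg lab x Γ).cod = lab x :: (Γ.erase x).map lab := by
  induction Γ with
  | nil => simp at hx
  | cons y Γ ih =>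
    by_cases h : y = x
    · subst h; simp
    · have hx' : x ∈ Γ := by simpa [Ne.symm h] using hx
      simp [pull_cons_ne h, ih hx', List.erase_cons_tail, h]

/-- Induction on `Γ`. If the first wire is `x` or `y`, one of the extractions is trivial, and at
most an involutive pair of crossings has to cancel; otherwise the first wire is crossed by both,
which is the braid relation. -/
theorem pull_comm {x y : V} (h : y ≠ x) {Γ : List V} (hx : x ∈ Γ) (hy : y ∈ Γ) :
    pull Sg lab y Γ ⨾ ident Sg [lab y] * pull Sg lab x (Γ.erase y) ⨾
        sym Sg [lab y] [lab x] * ident Sg (((Γ.erase y).erase x).map lab) =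
      pull Sg lab x Γ ⨾ ident Sg [lab x] * pull Sg lab y (Γ.erase x) := by
  induction Γ with
  | nil => simp at hx
  | cons z Γ ih =>
    by_cases hzy : z = y
    · subst hzy
      have hx' : x ∈ Γ := by simpa [Ne.symm h] using hx
      rw [pull_cons_self, pull_cons_ne h, List.erase_cons_head, List.erase_cons_tail (by simpa),
        pull_cons_self, id_mul_id, comp_id _ (by simp [hx']), id_comp _ (by simp)]
    by_cases hzx : z = x
    · subst hzx
      have hy' : y ∈ Γ := by simpa [h] using hy
      rw [pull_cons_self, pull_cons_ne (Ne.symm h), List.erase_cons_head,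
        List.erase_cons_tail (by simpa using hzy),
        pull_cons_self, id_mul_id, id_comp (sym _ _ _ * _) (by simp), id_comp _ (by simp),
        List.erase_cons_head, assoc _ _ _ (by simp [hy']) (by simp),
        ← comp_mul_id _ _ _ (by simp), swap_swap, id_mul_id, comp_id _ (by simp [hy'])]
    · have hx' : x ∈ Γ := by simpa [Ne.symm hzx] using hx
      have hy' : y ∈ Γ := by simpa [Ne.symm hzy] using hy
      have hxy : x ∈ Γ.erase y := (List.mem_erase_of_ne (Ne.symm h)).2 hx'
      have hyx : y ∈ Γ.erase x := (List.mem_erase_of_ne h).2 hy'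
      rw [pull_cons_ne hzx, pull_cons_ne hzy, List.erase_cons_tail (by simpa),
        List.erase_cons_tail (by simpa), List.erase_cons_tail (by simpa),
        pull_cons_ne hzx, pull_cons_ne hzy]
      have := ih hx' hy'
      rw [List.erase_comm x y]
      rw [List.map_cons]
      exact braid_whisker (by simp [hy']) (by simp) (by simp [hxy])
        (by simp [hx']) (by simp) (by simp [hyx, List.erase_comm x y]) this

@[simp] theorem dom_perm {Γ Δ : List V} (h : Γ.Perm Δ) : (perm Sg lab Γ Δ).dom = Γ.map lab := by
  cases Δ with
  | nil => simp [perm, h.eq_nil]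
  | cons x Δ => simp [perm]

@[simp] theorem cod_perm {Γ Δ : List V} (h : Γ.Perm Δ) : (perm Sg lab Γ Δ).cod = Δ.map lab := by
  induction Δ generalizing Γ with
  | nil => simp [perm]
  | cons x Δ ih =>
    have hx : x ∈ Γ := h.symm.subset (by simp)
    have h' : (Γ.erase x).Perm Δ := by simpa using h.erase x
    simp [perm, hx, ih h', h']

@[simp] theorem perm_self (Γ : List V) : perm Sg lab Γ Γ = ident Sg (Γ.map lab) := by
  induction Γ with
  | nil => simp [perm, id_nil]
  | cons x Γ ih => simp [perm, ih, id_mul_id]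

/-- A single wire can be extracted before or after the others are permuted. This is the one-wire
case of functoriality, from which `perm_comp` follows; the induction rests on `pull_comm`. -/
theorem perm_pull {x : V} {Γ Δ : List V} (h : Γ.Perm Δ) (hx : x ∈ Γ) :
    perm Sg lab Γ Δ ⨾ pull Sg lab x Δ =
      pull Sg lab x Γ ⨾ ident Sg [lab x] * perm Sg lab (Γ.erase x) (Δ.erase x) := by
  induction Δ generalizing Γ with
  | nil => simp [h.eq_nil] at hx
  | cons y Δ ih =>
    have hy : y ∈ Γ := h.symm.subset (by simp)
    have h' : (Γ.erase y).Perm Δ := by simpa using h.erase y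
    by_cases hyx : y = x
    · subst hyx
      rw [pull_cons_self, comp_id _ (by simp [h]), List.erase_cons_head, perm]
    · have hx' : x ∈ Γ.erase y := (List.mem_erase_of_ne (Ne.symm hyx)).2 hx
      have hy' : y ∈ Γ.erase x := (List.mem_erase_of_ne hyx).2 hy
      have hx'' : x ∈ Δ := h'.subset hx'
      have h'' : ((Γ.erase x).erase y).Perm (Δ.erase x) := by
        rw [List.erase_comm]; exact h'.erase x
      have h3 : ((Γ.erase y).erase x).Perm (Δ.erase x) := h'.erase x
      have hE : (Γ.erase x).erase y = (Γ.erase y).erase x := List.erase_comm ..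
      rw [perm, pull_cons_ne hyx, List.erase_cons_tail (by simpa), perm, hE]
      rw [hE] at h''
      have hn : ident Sg [lab y] * (ident Sg [lab x] * perm Sg lab ((Γ.erase y).erase x) (Δ.erase x)) ⨾
          sym Sg [lab y] [lab x] * ident Sg ((Δ.erase x).map lab) =
          sym Sg [lab y] [lab x] * ident Sg (((Γ.erase y).erase x).map lab) ⨾
          ident Sg [lab x] * (ident Sg [lab y] * perm Sg lab ((Γ.erase y).erase x) (Δ.erase x)) := by
        have := mul_eq_right_left (sym Sg [lab y] [lab x])
          (perm Sg lab ((Γ.erase y).erase x) (Δ.erase x))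
        rw [mul_eq_left_right] at this
        simpa [h'', ← mul_assoc, id_mul_id] using this.symm
      calc _ = pull Sg lab y Γ ⨾ ident Sg [lab y] * (perm Sg lab (Γ.erase y) Δ ⨾ pull Sg lab x Δ) ⨾
            sym Sg [lab y] [lab x] * ident Sg ((Δ.erase x).map lab) := by
            rw [id_mul_comp _ _ _ (by simp [h'])]
            simp [assoc, hy, h', hx'']
        _ = pull Sg lab y Γ ⨾ ident Sg [lab y] * pull Sg lab x (Γ.erase y) ⨾
            sym Sg [lab y] [lab x] * ident Sg (((Γ.erase y).erase x).map lab) ⨾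
            ident Sg [lab x] * (ident Sg [lab y] * perm Sg lab ((Γ.erase y).erase x) (Δ.erase x)) := by
            rw [ih h' hx', id_mul_comp _ _ _ (by simp [hx', h'']), ← hn]
            simp [assoc, hx', h'']
        _ = (pull Sg lab x Γ ⨾ ident Sg [lab x] * pull Sg lab y (Γ.erase x)) ⨾
            ident Sg [lab x] * (ident Sg [lab y] * perm Sg lab ((Γ.erase y).erase x) (Δ.erase x)) := by
            rw [← pull_comm hyx hx hy]
            rw [assoc _ _ _ (by simp [hy]) (by simp [hx', h'']), assoc _ _ _ (by simp [hx'])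
              (by simp [h''])]
        _ = _ := by
            rw [id_mul_comp _ _ _ (by simp [hy', hE, h''])]
            simp [assoc, hx, hy', hE, h'']

/-- Coherence: the composite forgets the intermediate order. By `perm_pull` the first wire of `Θ`
can be extracted directly from `Γ`, and the rest is the same problem with that wire erased. -/
theorem perm_comp {Γ Δ Θ : List V} (h : Γ.Perm Δ) (h' : Δ.Perm Θ) :
    perm Sg lab Γ Δ ⨾ perm Sg lab Δ Θ = perm Sg lab Γ Θ := by
  induction Θ generalizing Γ Δ with
  | nil => 
    have := h'.eq_nil
    subst this
    simp [perm, ← id_nil]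
  | cons x Θ ih =>
    have hx : x ∈ Δ := h'.symm.subset (by simp)
    have hx' : x ∈ Γ := h.symm.subset hx
    have hΔ : (Δ.erase x).Perm Θ := by simpa using h'.erase x
    have hΓ : (Γ.erase x).Perm (Δ.erase x) := h.erase x
    rw [perm, perm, ← assoc _ _ _ (by simp [h]) (by simp [hx, hΔ]), perm_pull h hx',
      assoc _ _ _ (by simp [hx', hΓ]) (by simp [hΓ, hΔ]), ← id_mul_comp _ _ _ (by simp [hΓ, hΔ]),
      ih hΓ hΔ]

theorem pull_append {x : V} {Γ : List V} (hx : x ∈ Γ) (Δ : List V) :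
    pull Sg lab x (Γ ++ Δ) = pull Sg lab x Γ * ident Sg (Δ.map lab) := by
  induction Γ with
  | nil => simp at hx
  | cons y Γ ih =>
    by_cases h : y = x
    · subst h; simp [id_mul_id]
    · have hx' : x ∈ Γ := by simpa [Ne.symm h] using hx
      rw [List.cons_append, pull_cons_ne h, pull_cons_ne h, ih hx', List.erase_append_left _ hx',
        comp_mul_id _ _ _ (by simp [hx']), List.map_append, ← id_mul_id, mul_assoc, mul_assoc]

theorem perm_append {Γ Γ' Δ Δ' : List V} (h : Γ.Perm Γ') (h' : Δ.Perm Δ') :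
    perm Sg lab (Γ ++ Δ) (Γ' ++ Δ') = perm Sg lab Γ Γ' * perm Sg lab Δ Δ' := by
  induction Γ' generalizing Γ with
  | nil => simp [h.eq_nil, perm]
  | cons x Γ' ih =>
    have hx : x ∈ Γ := h.symm.subset (by simp)
    have hΓ : (Γ.erase x).Perm Γ' := by simpa using h.erase x
    rw [List.cons_append, perm, perm, pull_append hx, List.erase_append_left _ hx, ih hΓ,
      ← mul_assoc, ← interchange _ _ _ _ (by simp [hx, hΓ]) (by simp [h']), id_comp _ (by simp [h'])]

theorem pull_append_cons {x : V} {Γ : List V} (hx : x ∉ Γ) (Δ : List V) :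
    pull Sg lab x (Γ ++ x :: Δ) = sym Sg (Γ.map lab) [lab x] * ident Sg (Δ.map lab) := by
  induction Γ with
  | nil => simp [nil_swap, id_mul_id]
  | cons y Γ ih =>
    have h : y ≠ x := by rintro rfl; simp at hx
    have hx' : x ∉ Γ := by simp_all
    rw [List.cons_append, pull_cons_ne h, ih hx', List.erase_append_right _ hx',
      List.erase_cons_head, List.map_append, ← id_mul_id, ← mul_assoc, ← mul_assoc,
      ← comp_mul_id _ _ _ (by simp), ← append_swap]
    rfl

/-- This identifies the primitive symmetry with a permutation of names. Names must be distinct,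
because `pull` takes the first occurrence of a wire. -/
theorem perm_swap {Γ Δ : List V} (h : (Γ ++ Δ).Nodup) :
    perm Sg lab (Γ ++ Δ) (Δ ++ Γ) = sym Sg (Γ.map lab) (Δ.map lab) := by
  induction Δ with
  | nil => simp [swap_nil]
  | cons x Δ ih =>
    have hx : x ∉ Γ := fun hx => (List.nodup_append.1 h).2.2 x hx x (by simp) rfl
    have h' : (Γ ++ Δ).Nodup := h.sublist (by simp)
    rw [List.cons_append, perm, pull_append_cons hx, List.erase_append_right _ hx,
      List.erase_cons_head, ih h', ← swap_append]
    rfl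

end Perm

/-! ### Moving boxes past permutations and past each other -/

theorem append_left_comm_perm {V : Type*} (X Y Z : List V) : (X ++ (Y ++ Z)).Perm (Y ++ (X ++ Z)) := by
  simpa using (List.perm_append_comm (l₁ := X) (l₂ := Y)).append_right Z

section Naturality

variable {V : Type*} [DecidableEq V] {lab : V → Ty B} {f : Mor Sg} {S T X Δ Δ' : List V}

theorem mul_id_comp_perm (hf : f.dom = S.map lab) (hf' : f.cod = T.map lab) (h : Δ.Perm Δ') :
    f * ident Sg (Δ.map lab) ⨾ perm Sg lab (T ++ Δ) (T ++ Δ') =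
      perm Sg lab (S ++ Δ) (S ++ Δ') ⨾ f * ident Sg (Δ'.map lab) := by
  have := mul_eq_left_right f (perm Sg lab Δ Δ')
  rw [mul_eq_right_left] at this
  rw [perm_append (.refl _) h, perm_append (.refl _) h, perm_self, perm_self]
  simpa [h, hf, hf'] using this.symm

theorem perm_comp_mul_id (hf : f.dom = S.map lab) (hf' : f.cod = T.map lab)
    (hS : (X ++ S).Nodup) (hT : (X ++ T).Nodup) :
    perm Sg lab (X ++ (S ++ Δ)) (S ++ (X ++ Δ)) ⨾ f * ident Sg ((X ++ Δ).map lab) =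
      ident Sg (X.map lab) * f * ident Sg (Δ.map lab) ⨾
        perm Sg lab (X ++ (T ++ Δ)) (T ++ (X ++ Δ)) := by
  simp only [← List.append_assoc]
  rw [perm_append List.perm_append_comm (.refl _), perm_append List.perm_append_comm (.refl _),
    perm_swap hS, perm_swap hT, perm_self, List.map_append, ← id_mul_id, ← mul_assoc,
    ← comp_mul_id _ _ _ (by simp [hf]), ← comp_mul_id _ _ _ (by simp [hf'])]
  have := swap_natural (ident Sg (X.map lab)) f
  rw [hf, hf'] at this
  exact congrArg (· * _) this.symm

theorem mul_id_comp_perm_swap (hf : f.dom = S.map lab) (hf' : f.cod = T.map lab)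
    (hS : (S ++ X).Nodup) (hT : (T ++ X).Nodup) :
    f * ident Sg ((X ++ Δ).map lab) ⨾ perm Sg lab (T ++ (X ++ Δ)) (X ++ (T ++ Δ)) =
      perm Sg lab (S ++ (X ++ Δ)) (X ++ (S ++ Δ)) ⨾
        ident Sg (X.map lab) * f * ident Sg (Δ.map lab) := by
  simp only [← List.append_assoc]
  rw [perm_append List.perm_append_comm (.refl _), perm_append List.perm_append_comm (.refl _),
    perm_swap hS, perm_swap hT, perm_self, List.map_append, ← id_mul_id, ← mul_assoc,
    ← comp_mul_id _ _ _ (by simp [hf']), ← comp_mul_id _ _ _ (by simp [hf])]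
  have := swap_natural f (ident Sg (X.map lab))
  rw [hf, hf'] at this
  exact congrArg (· * _) this

/-- By `hΘ`, the box `f'` takes its inputs from wires that `f` leaves alone, and `Δ` consists of the
wires that neither box touches. Naturality moves the permutations away until the boxes act on
adjacent blocks, where interchange applies. The distinctness hypotheses make block permutations into
symmetries; `k` is whatever follows. -/
theorem exchange {f' k : Mor Sg} {S' T' Γ Θ Θ' : List V} (hf : f.dom = S.map lab)
    (hf' : f.cod = T.map lab) (hg : f'.dom = S'.map lab) (hg' : f'.cod = T'.map lab)
    (hΓ : Γ.Perm (S ++ Θ)) (hΘ : Θ.Perm (S' ++ Δ)) (hΘ' : Θ'.Perm (T ++ Δ))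
    (n₁ : (S ++ S').Nodup) (n₂ : (T ++ S').Nodup) (n₃ : (T' ++ S).Nodup) (n₄ : (T' ++ T).Nodup)
    (hk : k.dom = (T' ++ Θ').map lab) :
    perm Sg lab Γ (S ++ Θ) ⨾ f * ident Sg (Θ.map lab) ⨾ perm Sg lab (T ++ Θ) (S' ++ Θ') ⨾
        f' * ident Sg (Θ'.map lab) ⨾ k =
      perm Sg lab Γ (S' ++ (S ++ Δ)) ⨾ f' * ident Sg ((S ++ Δ).map lab) ⨾
        perm Sg lab (T' ++ (S ++ Δ)) (S ++ (T' ++ Δ)) ⨾ f * ident Sg ((T' ++ Δ).map lab) ⨾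
        perm Sg lab (T ++ (T' ++ Δ)) (T' ++ Θ') ⨾ k := by
  have p₁ := append_left_comm_perm S S' Δ
  have p₂ := append_left_comm_perm T S' Δ
  have p₃ := append_left_comm_perm T' S Δ
  have p₃' := append_left_comm_perm S' S Δ
  have p₄ := append_left_comm_perm T T' Δ
  have q₁ : (S' ++ (T ++ Δ)).Perm (S' ++ Θ') := hΘ'.symm.append_left _
  have q₂ : (T' ++ (T ++ Δ)).Perm (T' ++ Θ') := hΘ'.symm.append_left _
  have q₃ : (T ++ Θ).Perm (T ++ (S' ++ Δ)) := hΘ.append_left _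
  have q₄ : (S ++ Θ).Perm (S ++ (S' ++ Δ)) := hΘ.append_left _
  have q₅ : Γ.Perm (S' ++ (S ++ Δ)) := (hΓ.trans q₄).trans p₁
  have n₁' : (S' ++ S).Nodup := List.perm_append_comm.nodup_iff.1 n₁
  have n₄' : (T ++ T').Nodup := List.perm_append_comm.nodup_iff.1 n₄
  -- The interchange law proper; the rest of the proof only moves permutations.
  have hfg : f * ident Sg ((S' ++ Δ).map lab) ⨾ ident Sg (T.map lab) * f' * ident Sg (Δ.map lab) =
      ident Sg (S.map lab) * f' * ident Sg (Δ.map lab) ⨾ f * ident Sg ((T' ++ Δ).map lab) := by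
    have := mul_eq_left_right f (f' * ident Sg (Δ.map lab))
    rw [mul_eq_right_left] at this
    simpa [hf, hf', hg, hg', mul_assoc] using this.symm
  have e₁ : (perm Sg lab (S' ++ (T ++ Δ)) (S' ++ Θ')).dom = (S' ++ (T ++ Δ)).map lab :=
    dom_perm q₁
  calc _ = perm Sg lab Γ (S ++ Θ) ⨾ f * ident Sg (Θ.map lab) ⨾
        perm Sg lab (T ++ Θ) (T ++ (S' ++ Δ)) ⨾ perm Sg lab (T ++ (S' ++ Δ)) (S' ++ (T ++ Δ)) ⨾
        perm Sg lab (S' ++ (T ++ Δ)) (S' ++ Θ') ⨾ f' * ident Sg (Θ'.map lab) ⨾ k := by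
        rw [comp_congr_left (perm_comp p₂ q₁) _ (by rw [cod_perm p₂, dom_perm q₁])
            (by rw [cod_perm q₁]; simp [hg]),
          comp_congr_left (perm_comp q₃ (p₂.trans q₁))]
        · rw [cod_perm q₃, dom_perm (p₂.trans q₁)]
        · rw [cod_perm (p₂.trans q₁)]; simp [hg]
    _ = perm Sg lab Γ (S ++ Θ) ⨾ perm Sg lab (S ++ Θ) (S ++ (S' ++ Δ)) ⨾
        f * ident Sg ((S' ++ Δ).map lab) ⨾ ident Sg (T.map lab) * f' * ident Sg (Δ.map lab) ⨾
        perm Sg lab (T ++ (T' ++ Δ)) (T' ++ (T ++ Δ)) ⨾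
        perm Sg lab (T' ++ (T ++ Δ)) (T' ++ Θ') ⨾ k := by
        rw [comp_congr_left₂ (mul_id_comp_perm hg hg' hΘ'.symm).symm k,
          comp_congr_left₂ (perm_comp_mul_id hg hg' n₂ n₄'),
          comp_congr_left₂ (mul_id_comp_perm hf hf' hΘ)]
        all_goals simp [cod_perm q₁, dom_perm q₂, dom_perm q₃,
          cod_perm q₃, cod_perm q₄, cod_perm p₂, dom_perm p₄,
          hf, hf', hg, hg', hk]
    _ = perm Sg lab Γ (S' ++ (S ++ Δ)) ⨾ perm Sg lab (S' ++ (S ++ Δ)) (S ++ (S' ++ Δ)) ⨾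
        ident Sg (S.map lab) * f' * ident Sg (Δ.map lab) ⨾ f * ident Sg ((T' ++ Δ).map lab) ⨾
        perm Sg lab (T ++ (T' ++ Δ)) (T' ++ Θ') ⨾ k := by
        rw [comp_congr_left (perm_comp p₄ q₂), comp_congr_left₂ hfg, comp_congr_left (perm_comp hΓ q₄),
          comp_congr_left (perm_comp q₅ p₃')]
        all_goals simp [dom_perm q₂, cod_perm q₂, cod_perm hΓ,
          cod_perm q₅, dom_perm q₄, cod_perm q₄, dom_perm p₃', cod_perm p₃',
          cod_perm p₄, dom_perm (p₄.trans q₂), hf, hf', hg, hg', hk]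
    _ = _ := by
        rw [comp_congr_left₂ (mul_id_comp_perm_swap hg hg' n₁' n₃).symm]
        all_goals simp [cod_perm p₃', dom_perm p₃, hf, hg, hg']

end Naturality

/-! ### Performing edges one after the other, and independence of the order -/

namespace Net

/-- `H.Run d Γ L out m`: when the edges `L` are performed one after the other, starting with wires
`Γ` and ending with wires `out`, and an edge `e` is interpreted as `d e`, the composite is `m`. -/
inductive Run (H : Net Sg) [DecidableEq H.V] (d : H.E → Mor Sg) :
    List H.V → List H.E → List H.V → Mor Sg → Prop
  | nil {Γ out : List H.V} : Γ.Nodup → Γ.Perm out → Run H d Γ [] out (perm Sg H.labV Γ out)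
  | cons {Γ out Δ : List H.V} {e : H.E} {L : List H.E} {m : Mor Sg} :
      Γ.Nodup → Γ.Perm (H.src e ++ Δ) → (d e).dom = (H.src e).map H.labV →
      (d e).cod = (H.tgt e).map H.labV → Run H d (H.tgt e ++ Δ) L out m →
      Run H d Γ (e :: L) out
        (perm Sg H.labV Γ (H.src e ++ Δ) ⨾ d e * ident Sg (Δ.map H.labV) ⨾ m)

namespace Run

variable {H : Net Sg} [DecidableEq H.V] {d : H.E → Mor Sg} {Γ Γ' out out' Θ : List H.V}
  {L L' : List H.E} {m m' : Mor Sg}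

theorem nodup (h : H.Run d Γ L out m) : Γ.Nodup := by cases h <;> assumption

theorem dom_eq (h : H.Run d Γ L out m) : m.dom = Γ.map H.labV := by
  cases h with
  | nil _ h => simp [h]
  | cons _ h => simp [h]

theorem cod_eq (h : H.Run d Γ L out m) : m.cod = out.map H.labV := by
  induction h with
  | nil _ h => simp [h]
  | cons _ h h1 h2 h3 ih => simp [h, h1, h2, h3.dom_eq, ih]

theorem perm_left (h : H.Run d Γ L out m) (hΓ : Γ'.Perm Γ) :
    H.Run d Γ' L out (perm Sg H.labV Γ' Γ ⨾ m) := by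
  cases h with
  | nil hn h =>
    rw [perm_comp hΓ h]
    exact .nil (hΓ.nodup_iff.2 hn) (hΓ.trans h)
  | cons hn h h1 h2 h3 =>
    rw [← assoc _ _ _ (by simp [hΓ, h]) (by simp [h, h1]), perm_comp hΓ h]
    exact .cons (hΓ.nodup_iff.2 hn) (hΓ.trans h) h1 h2 h3

theorem append (h : H.Run d Γ L Θ m) (h' : H.Run d Θ L' out m') :
    H.Run d Γ (L ++ L') out (m ⨾ m') := by
  induction h with
  | nil hn h => exact h'.perm_left h
  | cons hn h h1 h2 h3 ih =>
    have e1 := h3.dom_eq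
    have e2 := h3.cod_eq
    have e3 := h'.dom_eq
    rw [assoc _ _ _ (by simp [h, h1]) (by simp [h2, e1, e2, e3]),
      assoc _ _ _ (by simp [h2, e1]) (by simp [e2, e3])]
    exact .cons hn h h1 h2 (ih h')

theorem nodup_right (h : H.Run d Γ L out m) : out.Nodup := by
  induction h with
  | nil hn h => exact h.nodup_iff.1 hn
  | cons hn h h1 h2 h3 ih => exact ih

theorem perm_right (h : H.Run d Γ L out m) (ho : out.Perm out') :
    H.Run d Γ L out' (m ⨾ perm Sg H.labV out out') := by
  simpa using h.append (.nil h.nodup_right ho)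

/-- Idle wires can be carried along a run, provided that no edge of the run produces a wire with one
of their names; this is the role of `hL`. -/
theorem mul_id (h : H.Run d Γ L out m) (hn : (Γ ++ Θ).Nodup)
    (hL : ∀ e ∈ L, ∀ v ∈ H.tgt e, v ∉ Θ) :
    H.Run d (Γ ++ Θ) L (out ++ Θ) (m * ident Sg (Θ.map H.labV)) := by
  induction h with
  | nil hn' h =>
    rw [← perm_self, ← perm_append h (.refl _)]
    exact .nil hn (h.append_right _)
  | @cons Γ out Δ e L m hn' h h1 h2 h3 ih =>
    have hp := h.append_right Θ
    have e1 := h3.dom_eq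
    rw [comp_mul_id _ _ _ (by simp [h, h1]), comp_mul_id _ _ _ (by simp [h2, e1]), ← perm_self,
      ← perm_append h (.refl _), perm_self, mul_assoc, id_mul_id, ← List.map_append]
    rw [List.append_assoc] at hp ⊢
    refine .cons hn hp h1 h2 ?_
    rw [← List.append_assoc]
    refine ih ?_ (fun e he => hL e (by simp [he]))
    rw [List.nodup_append] at hn ⊢
    refine ⟨h3.nodup, hn.2.1, ?_⟩
    rintro a ha b hb rfl
    rcases List.mem_append.1 ha with ha | ha
    · exact hL e (by simp) a ha hb
    · exact hn.2.2 a (h.symm.subset (by simp [ha])) a hb rfl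

/-- Obtained from `mul_id` by conjugating with the symmetry. -/
theorem id_mul (h : H.Run d Γ L out m) (hn : (Θ ++ Γ).Nodup)
    (hL : ∀ e ∈ L, ∀ v ∈ H.tgt e, v ∉ Θ) :
    H.Run d (Θ ++ Γ) L (Θ ++ out) (ident Sg (Θ.map H.labV) * m) := by
  have hn' : (Γ ++ Θ).Nodup := List.perm_append_comm.nodup_iff.1 hn
  have h1 := ((h.mul_id hn' hL).perm_right (out' := Θ ++ out) List.perm_append_comm).perm_left
    (Γ' := Θ ++ Γ) List.perm_append_comm
  have hn2 := (h.mul_id hn' hL).nodup_right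
  have e1 := h.dom_eq
  have e2 := h.cod_eq
  rw [perm_swap hn, perm_swap hn2] at h1
  have h2 := swap_natural m (ident Sg (Θ.map H.labV))
  rw [e2, e1, cod_id, dom_id] at h2
  rwa [h2, ← assoc _ _ _ (by simp) (by simp [e1]), swap_swap, id_comp _ (by simp [e1])] at h1

/-- The edge `e` bubbles forward past its predecessors one at a time. An earlier edge `a` cannot
consume the sources of `e`, since each vertex is a source of at most one edge, and it does not have
to produce them, since they are in `Γ`. So `a` and `e` are independent and `exchange` applies. -/
theorem move_front (hH : H.IsHypernet) {e : H.E} {L₁ L₂ : List H.E}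
    (h : H.Run d Γ (L₁ ++ e :: L₂) out m) (hn : (L₁ ++ e :: L₂).Nodup)
    (hfresh : ∀ v ∈ Γ, ∀ e' ∈ L₁ ++ e :: L₂, v ∉ H.tgt e') (he : H.src e ⊆ Γ) :
    H.Run d Γ (e :: (L₁ ++ L₂)) out m := by
  induction L₁ generalizing Γ m with
  | nil => exact h
  | cons a L₁ ih =>
    rw [List.cons_append] at h hn hfresh
    rw [List.nodup_cons] at hn
    cases h with
    | @cons _ _ Δa _ _ m1 hΓ hp h1 h2 h3 =>
    have hea : e ≠ a := by rintro rfl; simp at hn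
    have hsub : H.src e ⊆ Δa := by
      intro v hv
      rcases List.mem_append.1 (hp.subset (he hv)) with h | h
      · exact absurd (hH.src_unique _ _ _ hv h) hea
      · exact h
    have hfresh' : ∀ v ∈ H.tgt a ++ Δa, ∀ e' ∈ L₁ ++ e :: L₂, v ∉ H.tgt e' := by
      intro v hv e' he' hve
      rcases List.mem_append.1 hv with hv | hv
      · obtain rfl := hH.tgt_unique _ _ _ hv hve
        exact hn.1 he'
      · exact hfresh v (hp.symm.subset (by simp [hv])) e' (List.mem_cons_of_mem _ he') hve
    have h4 := ih h3 hn.2 hfresh' (fun v hv => List.mem_append_right _ (hsub hv))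
    -- `Δ` consists of the wires consumed neither by `a` nor by `e`.
    obtain ⟨Δ, hΔ⟩ : ∃ Δ, Δa.Perm (H.src e ++ Δ) :=
      ⟨_, (List.subperm_append_diff_self_of_count_le fun x _ =>
        (List.subperm_of_subset (hH.src_nodup e) hsub).count_le x).symm⟩
    cases h4 with
    | @cons _ _ Δe _ _ m2 hΓ' hp' h1' h2' h3' =>
    have hΔe : Δe.Perm (H.tgt a ++ Δ) := by
      refine (List.perm_append_left_iff (H.src e)).1 (hp'.symm.trans ?_)
      refine (hΔ.append_left _).trans ?_
      simpa using (List.perm_append_comm (l₁ := H.tgt a) (l₂ := H.src e)).append_right Δ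
    have q1 : Γ.Perm (H.src a ++ (H.src e ++ Δ)) := hp.trans (hΔ.append_left _)
    have q2 : Γ.Perm (H.src e ++ (H.src a ++ Δ)) := q1.trans (append_left_comm_perm _ _ _)
    have q3 : (H.tgt a ++ (H.tgt e ++ Δ)).Perm (H.tgt e ++ Δe) := (append_left_comm_perm _ _ _).trans (hΔe.symm.append_left _)
    have n1 := q1.nodup_iff.1 hΓ
    have n2 := q2.nodup_iff.1 hΓ
    have n3 := q3.nodup_iff.2 h3'.nodup
    have n4 := (append_left_comm_perm _ _ _).nodup_iff.1 n3
    have n5 := (hΔ.append_left (H.tgt a)).nodup_iff.1 hΓ'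
    -- The wires of `H.src a ++ Δ` already occur in `Γ`, so by freshness none of them is a target of
    -- `e`.
    have n6 : (H.tgt e ++ (H.src a ++ Δ)).Nodup := by
      rw [List.nodup_append] at n4 n2 ⊢
      refine ⟨n4.1, n2.2.1, ?_⟩
      rintro v hv _ hv' rfl
      exact hfresh v (hp.symm.subset ((hΔ.append_left (H.src a)).symm.subset
        (List.mem_append.2 ((List.mem_append.1 hv').imp (fun h => h) (List.mem_append_right _))))) e
        (by simp) hv
    have sub : ∀ {X Y Z : List H.V}, (X ++ (Y ++ Z)).Nodup → (X ++ Y).Nodup := fun h =>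
      h.sublist (by simp)
    have key := Run.cons hΓ q2 h1' h2' (.cons (e := a) n6 (append_left_comm_perm _ _ _) h1 h2 (h3'.perm_left q3))
    have e2 := h3'.dom_eq
    rwa [exchange h1 h2 h1' h2' hp hΔ hΔe (sub n1) (sub n5) (sub n6) (sub n4) e2]

/-- The first edge of one run has all its sources in `Γ`, hence can be moved to the front of the
other run; then both continue with the same edges. -/
theorem unique (hH : H.IsHypernet) (h : H.Run d Γ L out m) (h' : H.Run d Γ L' out m')
    (hL : L.Perm L') (hn : L.Nodup) (hfresh : ∀ v ∈ Γ, ∀ e ∈ L, v ∉ H.tgt e) : m = m' := by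
  induction h generalizing L' m' with
  | nil hn h =>
    rw [hL.symm.eq_nil] at h'
    cases h'
    rfl
  | @cons Γ out Δ e L m hΓ h h1 h2 h3 ih =>
    obtain ⟨L₁, L₂, rfl⟩ := List.append_of_mem (hL.subset (List.mem_cons_self ..))
    have hL' : L.Perm (L₁ ++ L₂) := (List.perm_cons e).1 (hL.trans List.perm_middle)
    have h4 := h'.move_front hH (hL.nodup_iff.1 hn)
      (fun v hv e he => hfresh v hv e (hL.symm.subset he))
      (fun v hv => h.symm.subset (List.mem_append_left _ hv))
    cases h4 with
    | @cons _ _ Δ' _ _ m2 _ hp h1' h2' h3' =>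
    have hΔ : Δ.Perm Δ' := (List.perm_append_left_iff (H.src e)).1 (h.symm.trans hp)
    rw [List.nodup_cons] at hn
    -- The two runs may list the idle wires in different orders; the difference is a permutation,
    -- which is moved back through the edge.
    have := ih (h3'.perm_left (hΔ.append_left _)) hL' hn.2 ?_
    · have q₁ := hΔ.append_left (H.tgt e)
      have q₂ := hΔ.append_left (H.src e)
      rw [this, comp_congr_left₂ (mul_id_comp_perm h1 h2 hΔ),
        comp_congr_left (perm_comp h q₂)]
      all_goals simp [dom_perm q₁, cod_perm q₁, dom_perm q₂, cod_perm q₂, h, h1, h2, h3'.dom_eq]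
    · intro v hv e' he' hve
      rcases List.mem_append.1 hv with hv | hv
      · obtain rfl := hH.tgt_unique _ _ _ hv hve
        exact hn.1 he'
      · exact hfresh v (h.symm.subset (by simp [hv])) e' (List.mem_cons_of_mem _ he') hve

end Run
end Net
-- Shapes of parts of a net, and their invariance under the axioms
/-- `M` enumerates the edges of level `p`. -/
def Net.IsLevel (H : Net Sg) (p : Option H.E) (M : Multiset H.E) : Prop :=
  M.Nodup ∧ ∀ e, e ∈ M ↔ H.parE e = p

/-- `f.Sat Γ out M`: the part of the net `H` that consists of the edges `M` of one level,
with inputs `Γ` and outputs `out`, has the shape of the diagram `f`. -/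
def Diagram.Sat {H : Net Sg} : ∀ {A C : Obj B}, Diagram Sg A C → List H.V → List H.V →
    Multiset H.E → Prop
  | _, _, .id A, Γ, out, M => out = Γ ∧ Γ.map H.labV = A ∧ M = 0
  | _, _, .gen l, Γ, out, M => ∃ e, M = {e} ∧ H.labE e = some l ∧ H.src e = Γ ∧ H.tgt e = out ∧
      Γ.map H.labV = l.dom ∧ out.map H.labV = l.cod
  | _, _, .swap A C, Γ, out, M => ∃ Γ₁ Γ₂, Γ = Γ₁ ++ Γ₂ ∧ out = Γ₂ ++ Γ₁ ∧
      Γ₁.map H.labV = A ∧ Γ₂.map H.labV = C ∧ M = 0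
  | _, _, .comp f g, Γ, out, M => ∃ Θ M₁ M₂, f.Sat Γ Θ M₁ ∧ g.Sat Θ out M₂ ∧ M = M₁ + M₂
  | _, _, .tensor f g, Γ, out, M => ∃ Γ₁ Γ₂ out₁ out₂ M₁ M₂, f.Sat Γ₁ out₁ M₁ ∧
      g.Sat Γ₂ out₂ M₂ ∧ Γ = Γ₁ ++ Γ₂ ∧ out = out₁ ++ out₂ ∧ M = M₁ + M₂
  | _, _, .abs (Γ := Γ') (A := A) (C := C) f, Γ, out, M => ∃ e M', M = {e} ∧ H.labE e = none ∧
      H.src e = Γ ∧ H.tgt e = out ∧ Γ.map H.labV = Γ' ∧ out.map H.labV = [Ty.lolly A C] ∧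
      H.IsLevel (some e) M' ∧ f.Sat (H.inputs (some e)) (H.outputs (some e)) M'

theorem append_inj_of_map {α β : Type*} {f : α → β} {l₁ l₂ l₁' l₂' : List α}
    (h : l₁ ++ l₂ = l₁' ++ l₂') (hf : l₁.map f = l₁'.map f) : l₁ = l₁' ∧ l₂ = l₂' :=
  List.append_inj h (by simpa using congrArg List.length hf)

namespace Diagram

variable {H : Net Sg} {A C : Obj B} {Γ out : List H.V} {M : Multiset H.E}

theorem Sat.types {f : Diagram Sg A C} (h : f.Sat Γ out M) :
    Γ.map H.labV = A ∧ out.map H.labV = C := by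
  induction f generalizing Γ out M with
  | id A =>
    obtain ⟨rfl, h, -⟩ := h
    exact ⟨h, h⟩
  | gen l =>
    obtain ⟨e, -, -, -, -, h⟩ := h
    exact h
  | swap A C =>
    obtain ⟨Γ₁, Γ₂, rfl, rfl, rfl, rfl, -⟩ := h
    simp
  | comp f g ihf ihg =>
    obtain ⟨Θ, M₁, M₂, hf, hg, -⟩ := h
    exact ⟨(ihf hf).1, (ihg hg).2⟩
  | tensor f g ihf ihg =>
    obtain ⟨Γ₁, Γ₂, out₁, out₂, M₁, M₂, hf, hg, rfl, rfl, -⟩ := h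
    simp [ihf hf, ihg hg]
  | abs f ih =>
    obtain ⟨e, M', -, -, -, -, h₁, h₂, -⟩ := h
    exact ⟨h₁, h₂⟩

theorem sat_cast {A' C' : Obj B} (hA : A = A') (hC : C = C') (f : Diagram Sg A C) :
    (f.cast hA hC).Sat Γ out M ↔ f.Sat Γ out M := by
  subst hA hC
  rfl

end Diagram

open Diagram in
/-- Diagrams that are equal modulo the axioms have the same shape. -/
theorem SMCEq.sat_iff {H : Net Sg} {A C A' C' : Obj B} {f : Diagram Sg A C}
    {g : Diagram Sg A' C'} (h : SMCEq f g) (Γ out : List H.V) (M : Multiset H.E) :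
    f.Sat Γ out M ↔ g.Sat Γ out M := by
  induction h generalizing Γ out M with
  | refl f => rfl
  | symm _ ih => exact (ih ..).symm
  | trans _ _ ih ih' => exact (ih ..).trans (ih' ..)
  | comp_congr _ _ ih ih' => simp only [Sat, ih, ih']
  | tensor_congr _ _ ih ih' => simp only [Sat, ih, ih']
  | @abs_congr Γ' A C f f' _ ih => simp only [Sat, ih]
  | id_comp f =>
    simp only [Sat]
    constructor
    · rintro ⟨Θ, M₁, M₂, ⟨rfl, -, rfl⟩, h, rfl⟩
      simpa using h
    · exact fun h => ⟨Γ, 0, M, ⟨rfl, h.types.1, rfl⟩, h, by simp⟩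
  | comp_id f =>
    simp only [Sat]
    constructor
    · rintro ⟨Θ, M₁, M₂, h, ⟨rfl, -, rfl⟩, rfl⟩
      simpa using h
    · exact fun h => ⟨out, M, 0, h, ⟨rfl, h.types.2, rfl⟩, by simp⟩
  | comp_assoc f g h =>
    simp only [Sat]
    constructor
    · rintro ⟨Θ', _, M₃, ⟨Θ, M₁, M₂, h₁, h₂, rfl⟩, h₃, rfl⟩
      exact ⟨Θ, M₁, _, h₁, ⟨Θ', M₂, M₃, h₂, h₃, rfl⟩, add_assoc ..⟩
    · rintro ⟨Θ, M₁, _, h₁, ⟨Θ', M₂, M₃, h₂, h₃, rfl⟩, rfl⟩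
      exact ⟨Θ', _, M₃, ⟨Θ, M₁, M₂, h₁, h₂, rfl⟩, h₃, (add_assoc ..).symm⟩
  | tensor_id A C =>
    simp only [Sat]
    constructor
    · rintro ⟨Γ₁, Γ₂, _, _, _, _, ⟨rfl, rfl, rfl⟩, ⟨rfl, rfl, rfl⟩, rfl, rfl, rfl⟩
      simp
    · rintro ⟨rfl, h, rfl⟩
      obtain ⟨Γ₁, Γ₂, rfl, h₁, h₂⟩ := List.map_eq_append_iff.1 h
      exact ⟨_, _, _, _, _, _, ⟨rfl, h₁, rfl⟩, ⟨rfl, h₂, rfl⟩, rfl, rfl, rfl⟩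
  | interchange f g f' g' =>
    simp only [Sat]
    constructor
    · rintro ⟨Γ₁, Γ₂, o₁, o₂, _, _, ⟨Θ₁, M₁, M₂, h₁, h₂, rfl⟩, ⟨Θ₂, M₃, M₄, h₃, h₄, rfl⟩, rfl, rfl, rfl⟩
      exact ⟨Θ₁ ++ Θ₂, M₁ + M₃, M₂ + M₄, ⟨_, _, _, _, _, _, h₁, h₃, rfl, rfl, rfl⟩,
        ⟨_, _, _, _, _, _, h₂, h₄, rfl, rfl, rfl⟩, add_add_add_comm ..⟩
    · rintro ⟨_, _, _, ⟨Γ₁, Γ₂, Θ₁, Θ₂, M₁, M₃, h₁, h₃, rfl, rfl, rfl⟩,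
        ⟨Θ₁', Θ₂', o₁, o₂, M₂, M₄, h₂, h₄, hΘ, rfl, rfl⟩, rfl⟩
      -- The list between the two tensors is split twice; the types fix the lengths of the pieces,
      -- so the splittings agree.
      obtain ⟨rfl, rfl⟩ := append_inj_of_map hΘ (h₁.types.2.trans h₂.types.1.symm)
      exact ⟨Γ₁, Γ₂, o₁, o₂, _, _, ⟨Θ₁, M₁, M₂, h₁, h₂, rfl⟩, ⟨Θ₂, M₃, M₄, h₃, h₄, rfl⟩, rfl, rfl,
        add_add_add_comm ..⟩
  | tensor_assoc f g h =>
    simp only [Sat]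
    constructor
    · rintro ⟨_, Γ₃, _, o₃, _, M₃, ⟨Γ₁, Γ₂, o₁, o₂, M₁, M₂, h₁, h₂, rfl, rfl, rfl⟩, h₃, rfl, rfl, rfl⟩
      exact ⟨_, _, _, _, _, _, h₁, ⟨_, _, _, _, _, _, h₂, h₃, rfl, rfl, rfl⟩, by simp, by simp,
        add_assoc ..⟩
    · rintro ⟨Γ₁, _, o₁, _, M₁, _, h₁, ⟨Γ₂, Γ₃, o₂, o₃, M₂, M₃, h₂, h₃, rfl, rfl, rfl⟩, rfl, rfl, rfl⟩
      exact ⟨_, _, _, _, _, _, ⟨_, _, _, _, _, _, h₁, h₂, rfl, rfl, rfl⟩, h₃, by simp, by simp,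
        (add_assoc ..).symm⟩
  | unit_tensor f =>
    simp only [Sat]
    constructor
    · rintro ⟨Γ₁, Γ₂, _, o₂, _, M₂, ⟨rfl, h, rfl⟩, h', rfl, rfl, rfl⟩
      obtain rfl := List.map_eq_nil_iff.1 h
      simpa using h'
    · exact fun h => ⟨[], Γ, [], out, 0, M, ⟨rfl, rfl, rfl⟩, h, by simp⟩
  | tensor_unit f =>
    simp only [Sat]
    constructor
    · rintro ⟨Γ₁, Γ₂, o₁, _, M₁, _, h', ⟨rfl, h, rfl⟩, rfl, rfl, rfl⟩
      obtain rfl := List.map_eq_nil_iff.1 h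
      simpa using h'
    · exact fun h => ⟨Γ, [], out, [], M, 0, h, ⟨rfl, rfl, rfl⟩, by simp⟩
  | swap_natural f g =>
    simp only [Sat]
    constructor
    · rintro ⟨_, _, _, ⟨Γ₁, Γ₂, o₁, o₂, M₁, M₂, h₁, h₂, rfl, rfl, rfl⟩, ⟨o₁', o₂', h, rfl, t₁, t₂, rfl⟩, rfl⟩
      obtain ⟨rfl, rfl⟩ := append_inj_of_map h (h₁.types.2.trans t₁.symm)
      exact ⟨Γ₂ ++ Γ₁, 0, M₂ + M₁, ⟨_, _, rfl, rfl, h₁.types.1, h₂.types.1, rfl⟩,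
        ⟨_, _, _, _, _, _, h₂, h₁, rfl, rfl, rfl⟩, by simp [add_comm]⟩
    · rintro ⟨_, _, _, ⟨Γ₁, Γ₂, rfl, rfl, t₁, t₂, rfl⟩, ⟨Γ₂', Γ₁', o₂, o₁, M₂, M₁, h₂, h₁, h, rfl, rfl⟩, rfl⟩
      obtain ⟨rfl, rfl⟩ := append_inj_of_map h (t₂.trans h₂.types.1.symm)
      exact ⟨o₁ ++ o₂, M₁ + M₂, 0, ⟨_, _, _, _, _, _, h₁, h₂, rfl, rfl, rfl⟩,
        ⟨_, _, rfl, rfl, h₁.types.2, h₂.types.2, rfl⟩, by simp [add_comm]⟩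
  | swap_swap A C =>
    simp only [Sat]
    constructor
    · rintro ⟨_, _, _, ⟨Γ₁, Γ₂, rfl, rfl, t₁, t₂, rfl⟩, ⟨Γ₂', Γ₁', h, rfl, t₂', t₁', rfl⟩, rfl⟩
      obtain ⟨rfl, rfl⟩ := append_inj_of_map h (t₂.trans t₂'.symm)
      simp [t₁, t₂]
    · rintro ⟨rfl, h, rfl⟩
      obtain ⟨Γ₁, Γ₂, rfl, h₁, h₂⟩ := List.map_eq_append_iff.1 h
      exact ⟨Γ₂ ++ Γ₁, 0, 0, ⟨_, _, rfl, rfl, h₁, h₂, rfl⟩, ⟨_, _, rfl, rfl, h₂, h₁, rfl⟩, rfl⟩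
  | swap_unit A =>
    simp only [Sat]
    constructor
    · rintro ⟨Γ₁, Γ₂, rfl, rfl, t₁, t₂, rfl⟩
      obtain rfl := List.map_eq_nil_iff.1 t₂
      simpa using t₁
    · rintro ⟨rfl, h, rfl⟩
      exact ⟨out, [], by simp, by simp, h, rfl, rfl⟩
  | hexagon A C D =>
    simp only [Sat, sat_cast]
    constructor
    · rintro ⟨Γ₁, _, rfl, rfl, t₁, h, rfl⟩
      obtain ⟨Γ₂, Γ₃, rfl, t₂, t₃⟩ := List.map_eq_append_iff.1 h
      exact ⟨Γ₂ ++ Γ₁ ++ Γ₃, 0, 0,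
        ⟨Γ₁ ++ Γ₂, Γ₃, Γ₂ ++ Γ₁, Γ₃, 0, 0, ⟨_, _, rfl, rfl, t₁, t₂, rfl⟩, ⟨rfl, t₃, rfl⟩, by simp⟩,
        ⟨Γ₂, Γ₁ ++ Γ₃, Γ₂, Γ₃ ++ Γ₁, 0, 0, ⟨rfl, t₂, rfl⟩, ⟨_, _, rfl, rfl, t₁, t₃, rfl⟩, by simp⟩, rfl⟩
    · rintro ⟨_, _, _, ⟨_, Γ₃, _, _, _, _, ⟨Γ₁, Γ₂, rfl, rfl, t₁, t₂, rfl⟩, ⟨rfl, t₃, rfl⟩, rfl, rfl, rfl⟩,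
        ⟨Γ₂', _, _, _, _, _, ⟨rfl, t₂', rfl⟩, ⟨Γ₁', Γ₃', rfl, rfl, t₁', t₃', rfl⟩, h, rfl, rfl⟩, rfl⟩
      rw [List.append_assoc] at h
      obtain ⟨rfl, h'⟩ := append_inj_of_map h (t₂.trans t₂'.symm)
      obtain ⟨rfl, rfl⟩ := append_inj_of_map h' (t₁.trans t₁'.symm)
      exact ⟨Γ₁, _, List.append_assoc .., (List.append_assoc ..).symm, t₁, by simp [t₂, t₃], rfl⟩

/-! ### Homomorphisms of nets -/

namespace Net

/-- A map of nets which preserves everything except possibly the outermost interfaces and the set of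
outermost edges: on the inside of edges, it is bijective on the edges of every level. -/
structure Hom (H K : Net Sg) where
  onV : H.V → K.V
  onE : H.E → K.E
  src_eq : ∀ e, K.src (onE e) = (H.src e).map onV
  tgt_eq : ∀ e, K.tgt (onE e) = (H.tgt e).map onV
  labV_eq : ∀ v, K.labV (onV v) = H.labV v
  labE_eq : ∀ e, K.labE (onE e) = H.labE e
  inputs_eq : ∀ e, K.inputs (some (onE e)) = (H.inputs (some e)).map onV
  outputs_eq : ∀ e, K.outputs (some (onE e)) = (H.outputs (some e)).map onV
  level : ∀ e M, H.IsLevel (some e) M → K.IsLevel (some (onE e)) (M.map onE)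

theorem IsLevel.eq {H : Net Sg} {p : Option H.E} {M M' : Multiset H.E} (h : H.IsLevel p M)
    (h' : H.IsLevel p M') : M = M' :=
  (Multiset.Nodup.ext h.1 h'.1).2 fun e => (h.2 e).trans (h'.2 e).symm

theorem exists_isLevel (H : Net Sg) [Finite H.E] (p : Option H.E) : ∃ M, H.IsLevel p M :=
  ⟨(Set.toFinite {e | H.parE e = p}).toFinset.val, Finset.nodup _, fun e => by simp⟩

theorem Hom.labV_comp {H K : Net Sg} (φ : Hom H K) : K.labV ∘ φ.onV = H.labV :=
  funext φ.labV_eq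

/-- A shape refers only to sources, targets, labels, inner interfaces and inner levels, which are
exactly the data that a homomorphism respects. Bijectivity on inner levels is needed for
abstractions; injectivity on vertices is not needed. -/
theorem Hom.sat {H K : Net Sg} (φ : Hom H K) {A C : Obj B} {f : Diagram Sg A C}
    {Γ out : List H.V} {M : Multiset H.E} (h : f.Sat Γ out M) :
    f.Sat (Γ.map φ.onV) (out.map φ.onV) (M.map φ.onE) := by
  induction f generalizing Γ out M with
  | id A =>
    obtain ⟨rfl, rfl, rfl⟩ := h
    simp [Diagram.Sat, φ.labV_comp]
  | gen l =>
    obtain ⟨e, rfl, h, rfl, rfl, h₁, h₂⟩ := h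
    exact ⟨φ.onE e, by simp, by rw [φ.labE_eq, h], φ.src_eq e, φ.tgt_eq e,
      by simpa [φ.labV_comp] using h₁, by simpa [φ.labV_comp] using h₂⟩
  | swap A C =>
    obtain ⟨Γ₁, Γ₂, rfl, rfl, rfl, rfl, rfl⟩ := h
    exact ⟨Γ₁.map φ.onV, Γ₂.map φ.onV, by simp, by simp, by simp [φ.labV_comp],
      by simp [φ.labV_comp], by simp⟩
  | comp f g ihf ihg =>
    obtain ⟨Θ, M₁, M₂, hf, hg, rfl⟩ := h
    exact ⟨_, _, _, ihf hf, ihg hg, by simp⟩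
  | tensor f g ihf ihg =>
    obtain ⟨Γ₁, Γ₂, out₁, out₂, M₁, M₂, hf, hg, rfl, rfl, rfl⟩ := h
    exact ⟨_, _, _, _, _, _, ihf hf, ihg hg, by simp⟩
  | abs f ih =>
    obtain ⟨e, M', rfl, h, rfl, rfl, h₁, h₂, h₃, hf⟩ := h
    refine ⟨φ.onE e, M'.map φ.onE, by simp, by rw [φ.labE_eq, h], φ.src_eq e, φ.tgt_eq e,
      by simpa [φ.labV_comp] using h₁, by simpa [φ.labV_comp] using h₂, φ.level e M' h₃, ?_⟩
    rw [φ.inputs_eq, φ.outputs_eq]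
    exact ih hf

theorem IsLevel.map_equiv {H K : Net Sg} {p : Option H.E} {M : Multiset H.E}
    (h : H.IsLevel p M) (σ : H.E ≃ K.E) (hσ : ∀ e, K.parE (σ e) = (H.parE e).map σ) :
    K.IsLevel (p.map σ) (M.map σ) := by
  refine ⟨h.1.map σ.injective, fun e => ?_⟩
  obtain ⟨e, rfl⟩ := σ.surjective e
  rw [Multiset.mem_map_of_injective σ.injective, h.2, hσ,
    (Option.map_injective σ.injective).eq_iff]

/-- An isomorphism as a homomorphism. -/
def Iso.toHom {H K : Net Sg} (φ : Iso H K) : Hom H K where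
  onV := φ.onV
  onE := φ.onE
  src_eq := φ.src_eq
  tgt_eq := φ.tgt_eq
  labV_eq := φ.labV_eq
  labE_eq := φ.labE_eq
  inputs_eq e := φ.inputs_eq (some e)
  outputs_eq e := φ.outputs_eq (some e)
  level e _ h := h.map_equiv (p := some e) φ.onE φ.parE_eq

end Net

/-! ### Gluing, and sequential composites of hypernets -/

theorem mem_zip_of_lookup_eq_some {α β : Type*} [BEq α] [LawfulBEq α] {l : List (α × β)}
    {a : α} {b : β} (h : l.lookup a = some b) : (a, b) ∈ l := by
  induction l with
  | nil => simp at h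
  | cons x l ih =>
    obtain ⟨a', b'⟩ := x
    rw [List.lookup_cons] at h
    split at h
    · simp_all
    · exact List.mem_cons_of_mem _ (ih h)

theorem lookup_zip_ne_none {α β : Type*} [BEq α] [LawfulBEq α] {l : List α} {l' : List β}
    (hl : l.length = l'.length) {a : α} (h : a ∈ l) : (l.zip l').lookup a ≠ none := by
  induction l generalizing l' with
  | nil => simp at h
  | cons x l ih =>
    cases l' with
    | nil => simp at hl
    | cons y l' =>
      rw [List.zip_cons_cons, List.lookup_cons]
      split
      · simp
      · rename_i hx
        refine ih (by simpa using hl) ?_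
        rcases List.mem_cons.1 h with rfl | h
        · simp at hx
        · exact h

theorem map_eq_map_of_forall_mem_zip {α β γ : Type*} {f : α → γ} {g : β → γ} {l : List α}
    {l' : List β} (hl : l.length = l'.length) (h : ∀ a b, (a, b) ∈ l.zip l' → f a = g b) :
    l.map f = l'.map g := by
  induction l generalizing l' with
  | nil => simp [List.length_eq_zero_iff.1 hl.symm]
  | cons x l ih =>
    cases l' with
    | nil => simp at hl
    | cons y l' =>
      simp only [List.zip_cons_cons, List.mem_cons] at h
      rw [List.map_cons, List.map_cons, h x y (.inl rfl),
        ih (by simpa using hl) fun a b hab => h a b (.inr hab)]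

theorem eq_of_mem_zip {α β : Type*} {l : List α} {l' : List β} (hn : l.Nodup) {a : α} {b b' : β}
    (h : (a, b) ∈ l.zip l') (h' : (a, b') ∈ l.zip l') : b = b' := by
  induction l generalizing l' with
  | nil => simp at h
  | cons x l ih =>
    cases l' with
    | nil => simp at h
    | cons y l' =>
      rw [List.nodup_cons] at hn
      simp only [List.zip_cons_cons, List.mem_cons, Prod.mk.injEq] at h h'
      rcases h with ⟨rfl, rfl⟩ | h <;> rcases h' with ⟨h1, rfl⟩ | h'
      · rfl
      · exact absurd (List.of_mem_zip h').1 hn.1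
      · subst h1
        exact absurd (List.of_mem_zip h).1 hn.1
      · exact ih hn.2 h h'

namespace Net

variable {H K : Net Sg}

/-- The height is the least number of parent steps from `e` to the outside. A numerical height is
easier to combine across constructions than the iterated parent function. -/
theorem exists_height (h : ∀ e, ∃ k, 1 ≤ k ∧
    (fun o : Option H.E => o.bind H.parE)^[k] (some e) = none) :
    ∃ r : H.E → ℕ, ∀ e e', H.parE e = some e' → r e' < r e := by
  classical
  refine ⟨fun e => Nat.find (h e), fun e e' he => ?_⟩
  obtain ⟨h1, h2⟩ := Nat.find_spec (h e)
  obtain ⟨k, hk⟩ := Nat.exists_eq_add_of_le' h1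
  rw [hk, Function.iterate_succ_apply] at h2
  simp only [Option.bind_some, he] at h2
  dsimp only
  rw [hk, Nat.lt_succ_iff]
  refine Nat.find_min' _ ⟨?_, h2⟩
  rcases Nat.eq_zero_or_pos k with rfl | hk
  · simp at h2
  · exact hk

theorem par_acyclic_of_height {r : H.E → ℕ} (hr : ∀ e e', H.parE e = some e' → r e' < r e)
    (e : H.E) : ∃ k, 1 ≤ k ∧ (fun o : Option H.E => o.bind H.parE)^[k] (some e) = none := by
  induction hn : r e using Nat.strong_induction_on generalizing e with
  | _ n ih =>
    cases he : H.parE e with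
    | none => exact ⟨1, le_rfl, by simpa using he⟩
    | some e' =>
      obtain ⟨k, -, h⟩ := ih _ (hn ▸ hr e e' he) e' rfl
      exact ⟨k + 1, by simp, by simpa [Function.iterate_succ_apply, he] using h⟩

/-- The rank counts the edges from which `e` can be reached; by acyclicity `e` is not among them, so
the count grows strictly along `Precedes`. -/
theorem exists_rank [Finite H.E] (h : ∀ e, ¬ Relation.TransGen H.Precedes e e) :
    ∃ r : H.E → ℕ, ∀ e e', H.Precedes e e' → r e < r e' := by
  refine ⟨fun e => {e' | Relation.TransGen H.Precedes e' e}.ncard, fun e e' he => ?_⟩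
  refine Set.ncard_lt_ncard ⟨fun a ha => ha.tail he, fun hs => ?_⟩
  exact h e (hs (Relation.TransGen.single he))

theorem acyclic_of_rank {r : H.E → ℕ} (hr : ∀ e e', H.Precedes e e' → r e < r e') (e : H.E) :
    ¬ Relation.TransGen H.Precedes e e := by
  have : ∀ a b, Relation.TransGen H.Precedes a b → r a < r b := by
    intro a b hab
    induction hab with
    | single h => exact hr _ _ h
    | tail _ h ih => exact ih.trans (hr _ _ h)
  exact fun h => lt_irrefl _ (this e e h)

theorem inputs_disjoint_tgt (hH : H.IsHypernet) {p : Option H.E} {v : H.V} (hv : v ∈ H.inputs p)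
    (e : H.E) : v ∉ H.tgt e := ((hH.mem_inputs p v).1 hv).2 e

theorem outputs_disjoint_src (hH : H.IsHypernet) {p : Option H.E} {v : H.V}
    (hv : v ∈ H.outputs p) (e : H.E) : v ∉ H.src e := ((hH.mem_outputs p v).1 hv).2 e

section Glue

theorem mem_zip_of_glue_eq_inl {v : K.V} {w : H.V} (h : glue H K v = Sum.inl w) :
    (v, w) ∈ (K.inputs none).zip (H.outputs none) := by
  classical
  unfold glue at h
  split at h
  · rename_i w' hw
    cases h
    exact mem_zip_of_lookup_eq_some hw
  · simp at h

theorem glue_of_partner {v : K.V} (h : partner H K v = none) : glue H K v = Sum.inr ⟨v, h⟩ := by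
  unfold glue
  split
  · simp_all
  · rfl

theorem length_inputs_eq (hl : K.inTypes = H.outTypes) : (K.inputs none).length = (H.outputs none).length := by
  simpa [inTypes, outTypes] using congrArg List.length hl

theorem glue_not_mem {v : K.V} (h : v ∉ K.inputs none) :
    ∃ h', glue H K v = Sum.inr ⟨v, h'⟩ := by
  cases hv : glue H K v with
  | inl w => exact absurd (List.of_mem_zip (mem_zip_of_glue_eq_inl hv)).1 h
  | inr x =>
    unfold glue at hv
    split at hv
    · simp at hv
    · cases hv
      exact ⟨_, rfl⟩

theorem not_mem_of_partner (hl : K.inTypes = H.outTypes) {v : K.V} (h : partner H K v = none) :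
    v ∉ K.inputs none := by
  classical
  exact fun hv => lookup_zip_ne_none (length_inputs_eq hl) hv h

/-- The defining property of the gluing. Since the inputs of `K` are distinct, the lookup that
defines `partner` finds the output in the same position. -/
theorem map_glue_inputs (hK : K.IsHypernet) (hl : K.inTypes = H.outTypes) :
    (K.inputs none).map (glue H K) = (H.outputs none).map Sum.inl := by
  refine map_eq_map_of_forall_mem_zip (length_inputs_eq hl) fun v w h => ?_
  cases hv : glue H K v with
  | inl w' => rw [eq_of_mem_zip (hK.inputs_nodup none) h (mem_zip_of_glue_eq_inl hv)]
  | inr x =>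
    unfold glue at hv
    split at hv
    · simp at hv
    · rename_i h'
      exact absurd (List.of_mem_zip h).1 (not_mem_of_partner hl h')

theorem glue_mem_outputs {v : K.V} {w : H.V} (h : glue H K v = Sum.inl w) :
    w ∈ H.outputs none :=
  (List.of_mem_zip (mem_zip_of_glue_eq_inl h)).2

theorem mem_inputs_of_glue {v : K.V} {w : H.V} (h : glue H K v = Sum.inl w) :
    v ∈ K.inputs none :=
  (List.of_mem_zip (mem_zip_of_glue_eq_inl h)).1

theorem exists_glue_eq (hK : K.IsHypernet) (hl : K.inTypes = H.outTypes) {w : H.V}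
    (hw : w ∈ H.outputs none) : ∃ v, glue H K v = Sum.inl w := by
  have : Sum.inl w ∈ (K.inputs none).map (glue H K) := by
    rw [map_glue_inputs hK hl]
    exact List.mem_map_of_mem hw
  obtain ⟨v, -, hv⟩ := List.mem_map.1 this
  exact ⟨v, hv⟩

/-- Distinct inputs of `K` go to distinct outputs of `H`, while all other vertices of `K` stay in
the second summand. -/
theorem glue_injective (hH : H.IsHypernet) (hK : K.IsHypernet) (hl : K.inTypes = H.outTypes) :
    Function.Injective (glue H K) := by
  intro v v' h
  by_cases hv : v ∈ K.inputs none
  · by_cases hv' : v' ∈ K.inputs none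
    · refine List.inj_on_of_nodup_map ?_ hv hv' h
      rw [map_glue_inputs hK hl]
      exact (hH.outputs_nodup none).map Sum.inl_injective
    · obtain ⟨_, h'⟩ := glue_not_mem (H := H) hv'
      have : glue H K v ∈ (K.inputs none).map (glue H K) := List.mem_map_of_mem hv
      rw [map_glue_inputs hK hl, h, h'] at this
      simp at this
  · obtain ⟨_, h'⟩ := glue_not_mem (H := H) hv
    by_cases hv' : v' ∈ K.inputs none
    · have : glue H K v' ∈ (K.inputs none).map (glue H K) := List.mem_map_of_mem hv'
      rw [map_glue_inputs hK hl, ← h, h'] at this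
      simp at this
    · obtain ⟨_, h''⟩ := glue_not_mem (H := H) hv'
      rw [h', h''] at h
      simpa using h

/-- A glued vertex is outermost in both nets, so its parent is `none` from either point of view. -/
theorem parV_glue (hH : H.IsHypernet) (hK : K.IsHypernet) (v : K.V) :
    (comp H K).parV (glue H K v) = (K.parV v).map Sum.inr := by
  cases h : glue H K v with
  | inl w =>
    simp [((hH.mem_outputs none w).1 (glue_mem_outputs h)).1,
      ((hK.mem_inputs none v).1 (mem_inputs_of_glue h)).1]
  | inr x =>
    have : glue H K x.1 = Sum.inr x := glue_of_partner x.2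
    by_cases hv : v ∈ K.inputs none
    · unfold glue at h
      split at h
      · simp at h
      · cases h; rfl
    · obtain ⟨_, h'⟩ := glue_not_mem (H := H) hv
      rw [h'] at h
      cases h
      rfl

theorem labV_glue (hK : K.IsHypernet) (hl : K.inTypes = H.outTypes) (v : K.V) :
    (comp H K).labV (glue H K v) = K.labV v := by
  by_cases hv : v ∈ K.inputs none
  · have : (K.inputs none).map ((comp H K).labV ∘ glue H K) = (K.inputs none).map K.labV := by
      rw [← List.map_map, map_glue_inputs hK hl, List.map_map]
      exact hl.symm
    exact List.map_inj_left.1 this v hv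
  · obtain ⟨_, h⟩ := glue_not_mem (H := H) hv
    rw [h]
    rfl

theorem not_inl_mem_map_glue_tgt (hK : K.IsHypernet) (e : K.E) (w : H.V) :
    Sum.inl w ∉ (K.tgt e).map (glue H K) := by
  intro h
  obtain ⟨v, hv, h⟩ := List.mem_map.1 h
  exact inputs_disjoint_tgt hK (mem_inputs_of_glue h) e hv

/-- Being an input of the composite is decided in `H` for a glued vertex, so here glued vertices
count as vertices of `H`. For outputs it is decided in `K`, whence the dual case distinction
`comp_cases'`. -/
theorem comp_cases (hl : K.inTypes = H.outTypes) (x : CompV H K) :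
    (∃ w, x = Sum.inl w) ∨ ∃ v, v ∉ K.inputs none ∧ x = glue H K v := by
  rcases x with w | ⟨v, hv⟩
  · exact .inl ⟨w, rfl⟩
  · exact .inr ⟨v, not_mem_of_partner hl hv, (glue_of_partner hv).symm⟩

theorem comp_cases' (hK : K.IsHypernet) (hl : K.inTypes = H.outTypes) (x : CompV H K) :
    (∃ w, w ∉ H.outputs none ∧ x = Sum.inl w) ∨ ∃ v, x = glue H K v := by
  rcases x with w | ⟨v, hv⟩
  · by_cases hw : w ∈ H.outputs none
    · obtain ⟨v, hv⟩ := exists_glue_eq hK hl hw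
      exact .inr ⟨v, hv.symm⟩
    · exact .inl ⟨w, hw, rfl⟩
  · exact .inr ⟨v, (glue_of_partner hv).symm⟩

theorem glue_mem_map_inl {v : K.V} {l : List H.V} (h : glue H K v ∈ l.map Sum.inl) :
    v ∈ K.inputs none ∧ ∃ w ∈ l, w ∈ H.outputs none ∧ glue H K v = Sum.inl w := by
  obtain ⟨w, hw, h⟩ := List.mem_map.1 h
  exact ⟨mem_inputs_of_glue h.symm, w, hw, glue_mem_outputs h.symm, h.symm⟩

theorem isHypernet_comp (hH : H.IsHypernet) (hK : K.IsHypernet) (hl : K.inTypes = H.outTypes) :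
    (comp H K).IsHypernet := by
  have := hH.finite_V
  have := hH.finite_E
  have := hK.finite_V
  have := hK.finite_E
  have hinj := glue_injective hH hK hl
  have hmem : ∀ {v : K.V} {l : List K.V}, glue H K v ∈ l.map (glue H K) ↔ v ∈ l :=
    List.mem_map_of_injective hinj
  have hmem' : ∀ {w : H.V} {l : List H.V}, (Sum.inl w : CompV H K) ∈ l.map Sum.inl ↔ w ∈ l :=
    List.mem_map_of_injective Sum.inl_injective
  have htgt := not_inl_mem_map_glue_tgt (H := H) hK
  have hpar := parV_glue hH hK
  -- A vertex of `K` that is identified with one of `H` is identified with an output of `H`, which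
  -- is never a source there.
  have hout : ∀ v e, glue H K v ∉ (H.src e).map Sum.inl := fun v e h =>
    let ⟨_, w, hw, hw', _⟩ := glue_mem_map_inl h
    outputs_disjoint_src hH hw' e hw
  obtain ⟨r, hr⟩ := exists_height hH.par_acyclic
  obtain ⟨r', hr'⟩ := exists_height hK.par_acyclic
  obtain ⟨s, hs⟩ := exists_rank hH.acyclic
  obtain ⟨s', hs'⟩ := exists_rank hK.acyclic
  -- Wires lead only from `H` to `K`, so shifting the ranks of `K` above the bound `N` gives a rank
  -- for the composite.
  obtain ⟨N, hN⟩ := (Set.finite_range s).bddAbove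
  have hN : ∀ e, s e ≤ N := fun e => hN ⟨e, rfl⟩
  have hin : ∀ w, (comp H K).IsInput (Sum.inl w) ↔ H.IsInput w := by
    intro w
    refine ⟨fun h e he => h (Sum.inl e) (List.mem_map_of_mem he), fun h e he => ?_⟩
    rcases e with e | e
    · exact h e (hmem'.1 he)
    · exact htgt e w he
  have hin' : ∀ v, v ∉ K.inputs none → ((comp H K).IsInput (glue H K v) ↔ K.IsInput v) := by
    intro v hv
    refine ⟨fun h e he => h (Sum.inr e) (List.mem_map_of_mem he), fun h e he => ?_⟩
    rcases e with e | e
    · exact hv (glue_mem_map_inl he).1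
    · exact h e (hmem.1 he)
  have ho : ∀ w, w ∉ H.outputs none → ((comp H K).IsOutput (Sum.inl w) ↔ H.IsOutput w) := by
    intro w hw
    refine ⟨fun h e he => h (Sum.inl e) (List.mem_map_of_mem he), fun h e he => ?_⟩
    rcases e with e | e
    · exact h e (hmem'.1 he)
    · obtain ⟨v, hv, h⟩ := List.mem_map.1 he
      exact hw (glue_mem_outputs h)
  have ho' : ∀ v, (comp H K).IsOutput (glue H K v) ↔ K.IsOutput v := by
    intro v
    refine ⟨fun h e he => h (Sum.inr e) (List.mem_map_of_mem he), fun h e he => ?_⟩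
    rcases e with e | e
    · exact hout v e he
    · exact h e (hmem.1 he)
  refine
    { finite_V := inferInstanceAs (Finite (H.V ⊕ _))
      finite_E := inferInstanceAs (Finite (H.E ⊕ K.E))
      par_src := ?_
      par_tgt := ?_
      par_acyclic := par_acyclic_of_height (r := Sum.elim r r') ?_
      acyclic := acyclic_of_rank (r := Sum.elim s (fun e => s' e + N + 1)) ?_
      src_nodup := ?_
      src_unique := ?_
      tgt_nodup := ?_
      tgt_unique := ?_
      inputs_nodup := ?_
      mem_inputs := ?_
      outputs_nodup := ?_
      mem_outputs := ?_
      labelled_empty := ?_ }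
  · rintro (e | e) v hv
    · obtain ⟨w, hw, rfl⟩ := List.mem_map.1 hv
      exact congrArg (Option.map Sum.inl) (hH.par_src e w hw)
    · obtain ⟨w, hw, rfl⟩ := List.mem_map.1 hv
      rw [hpar, hK.par_src e w hw]
      rfl
  · rintro (e | e) v hv
    · obtain ⟨w, hw, rfl⟩ := List.mem_map.1 hv
      exact congrArg (Option.map Sum.inl) (hH.par_tgt e w hw)
    · obtain ⟨w, hw, rfl⟩ := List.mem_map.1 hv
      rw [hpar, hK.par_tgt e w hw]
      rfl
  · rintro (e | e) (e' | e') h <;> simp at h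
    · exact hr _ _ h
    · exact hr' _ _ h
  · rintro (e | e) (e' | e') ⟨x, hx, hx'⟩
    · obtain ⟨w, hw, rfl⟩ := List.mem_map.1 hx
      exact hs _ _ ⟨w, hw, hmem'.1 hx'⟩
    · have := hN e
      simp only [Sum.elim_inl, Sum.elim_inr]
      omega
    · obtain ⟨w, hw, rfl⟩ := List.mem_map.1 hx'
      exact absurd hx (htgt e w)
    · obtain ⟨v, hv, rfl⟩ := List.mem_map.1 hx
      have := hs' _ _ ⟨v, hv, hmem.1 hx'⟩
      simp only [Sum.elim_inr]
      omega
  · rintro (e | e)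
    · exact (hH.src_nodup e).map Sum.inl_injective
    · exact (hK.src_nodup e).map hinj
  · rintro (e | e) (e' | e') x hx hx'
    · obtain ⟨w, hw, rfl⟩ := List.mem_map.1 hx
      rw [hH.src_unique _ _ w hw (hmem'.1 hx')]
    · obtain ⟨v, hv, rfl⟩ := List.mem_map.1 hx'
      exact absurd hx (hout _ _)
    · obtain ⟨v, hv, rfl⟩ := List.mem_map.1 hx
      exact absurd hx' (hout _ _)
    · obtain ⟨v, hv, rfl⟩ := List.mem_map.1 hx
      rw [hK.src_unique _ _ v hv (hmem.1 hx')]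
  · rintro (e | e)
    · exact (hH.tgt_nodup e).map Sum.inl_injective
    · exact (hK.tgt_nodup e).map hinj
  · rintro (e | e) (e' | e') x hx hx'
    · obtain ⟨w, hw, rfl⟩ := List.mem_map.1 hx
      rw [hH.tgt_unique _ _ w hw (hmem'.1 hx')]
    · obtain ⟨w, hw, rfl⟩ := List.mem_map.1 hx
      exact absurd hx' (htgt _ _)
    · obtain ⟨w, hw, rfl⟩ := List.mem_map.1 hx'
      exact absurd hx (htgt _ _)
    · obtain ⟨v, hv, rfl⟩ := List.mem_map.1 hx
      rw [hK.tgt_unique _ _ v hv (hmem.1 hx')]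
  · rintro (_ | e | e)
    · exact (hH.inputs_nodup none).map Sum.inl_injective
    · exact (hH.inputs_nodup (some e)).map Sum.inl_injective
    · exact (hK.inputs_nodup (some e)).map hinj
  · intro p x
    rcases comp_cases hl x with ⟨w, rfl⟩ | ⟨v, hv, rfl⟩
    · rw [hin]
      rcases p with _ | e | e
      · exact hmem'.trans ((hH.mem_inputs none w).trans (by simp))
      · exact hmem'.trans ((hH.mem_inputs (some e) w).trans (by simp))
      · refine iff_of_false (fun h => ?_) (by simp)
        obtain ⟨v, hv, h⟩ := List.mem_map.1 h
        have h1 := ((hK.mem_inputs _ _).1 (mem_inputs_of_glue h)).1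
        rw [((hK.mem_inputs _ _).1 hv).1] at h1
        simp at h1
    · rw [hin' v hv, hpar]
      rcases p with _ | e | e
      · refine iff_of_false (fun h => hv (glue_mem_map_inl h).1) fun h => hv ?_
        exact (hK.mem_inputs none v).2 (by simpa using h)
      · exact iff_of_false (fun h => hv (glue_mem_map_inl h).1) (by simp)
      · exact hmem.trans ((hK.mem_inputs (some e) v).trans (by simp))
  · rintro (_ | e | e)
    · exact (hK.outputs_nodup none).map hinj
    · exact (hH.outputs_nodup (some e)).map Sum.inl_injective
    · exact (hK.outputs_nodup (some e)).map hinj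
  · intro p x
    rcases comp_cases' hK hl x with ⟨w, hw, rfl⟩ | ⟨v, rfl⟩
    · rw [ho w hw]
      rcases p with _ | e | e
      · refine iff_of_false (fun h => ?_) fun h => hw ?_
        · obtain ⟨v, hv, h⟩ := List.mem_map.1 h
          exact hw (glue_mem_outputs h)
        · exact (hH.mem_outputs none w).2 (by simpa using h)
      · exact hmem'.trans ((hH.mem_outputs (some e) w).trans (by simp))
      · refine iff_of_false (fun h => ?_) (by simp)
        obtain ⟨v, hv, h⟩ := List.mem_map.1 h
        exact hw (glue_mem_outputs h)
    · rw [ho' v, hpar]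
      rcases p with _ | e | e
      · exact hmem.trans ((hK.mem_outputs none v).trans (by simp))
      · refine iff_of_false (fun h => ?_) (by simp)
        obtain ⟨_, w, hw, hw', -⟩ := glue_mem_map_inl h
        have h1 := ((hH.mem_outputs _ _).1 hw).1
        rw [((hH.mem_outputs _ _).1 hw').1] at h1
        simp at h1
      · exact hmem.trans ((hK.mem_outputs (some e) v).trans (by simp))
  · rintro (e | e) he
    · obtain ⟨h1, h2⟩ := hH.labelled_empty e he
      refine ⟨?_, ?_⟩
      · rintro (w | v) <;> simp [h1]
      · rintro (e' | e') <;> simp [h2]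
    · obtain ⟨h1, h2⟩ := hK.labelled_empty e he
      refine ⟨?_, ?_⟩
      · rintro (w | v) <;> simp [h1]
      · rintro (e' | e') <;> simp [h2]

end Glue

end Net
-- Interpretations are well-typed hypernets
namespace Net

variable {H K : Net Sg}

theorem wellTyped_comp (hH : H.WellTyped) (hK : K.WellTyped) (hKn : K.IsHypernet)
    (hl : K.inTypes = H.outTypes) : (comp H K).WellTyped := by
  have h2 : ∀ l : List K.V, (l.map (glue H K)).map (comp H K).labV = l.map K.labV := by
    intro l
    rw [List.map_map]
    exact List.map_congr_left fun v _ => labV_glue hKn hl v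
  have h1 : ∀ l : List H.V, (l.map Sum.inl).map (comp H K).labV = l.map H.labV := by
    intro l
    rw [List.map_map]
    rfl
  constructor
  · rintro (e | e) l he
    · exact ⟨(h1 _).trans (hH.labelled e l he).1, (h1 _).trans (hH.labelled e l he).2⟩
    · exact ⟨(h2 _).trans (hK.labelled e l he).1, (h2 _).trans (hK.labelled e l he).2⟩
  · rintro (e | e) he
    · obtain ⟨La, ha, hb⟩ := hH.unlabelled e he
      refine ⟨La, ?_, ?_⟩
      · exact (congrArg (· ++ La) (h1 _)).trans (ha.trans (h1 _).symm)
      · exact (h1 _).trans (hb.trans (congrArg (fun l => [Ty.lolly La l]) (h1 _).symm))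
    · obtain ⟨La, ha, hb⟩ := hK.unlabelled e he
      refine ⟨La, ?_, ?_⟩
      · exact (congrArg (· ++ La) (h2 _)).trans (ha.trans (h2 _).symm)
      · exact (h2 _).trans (hb.trans (congrArg (fun l => [Ty.lolly La l]) (h2 _).symm))

theorem isHypernet_tensor (hH : H.IsHypernet) (hK : K.IsHypernet) : (tensor H K).IsHypernet := by
  have := hH.finite_V
  have := hH.finite_E
  have := hK.finite_V
  have := hK.finite_E
  obtain ⟨r, hr⟩ := exists_height hH.par_acyclic
  obtain ⟨r', hr'⟩ := exists_height hK.par_acyclic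
  obtain ⟨s, hs⟩ := exists_rank hH.acyclic
  obtain ⟨s', hs'⟩ := exists_rank hK.acyclic
  refine
    { finite_V := inferInstanceAs (Finite (H.V ⊕ K.V))
      finite_E := inferInstanceAs (Finite (H.E ⊕ K.E))
      par_src := ?_
      par_tgt := ?_
      par_acyclic := par_acyclic_of_height (r := Sum.elim r r') ?_
      acyclic := acyclic_of_rank (r := Sum.elim s s') ?_
      src_nodup := ?_
      src_unique := ?_
      tgt_nodup := ?_
      tgt_unique := ?_
      inputs_nodup := ?_
      mem_inputs := ?_
      outputs_nodup := ?_
      mem_outputs := ?_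
      labelled_empty := ?_ }
  · rintro (e | e) (v | v) hv <;> simp at hv ⊢
    · rw [hH.par_src e v hv]
    · rw [hK.par_src e v hv]
  · rintro (e | e) (v | v) hv <;> simp at hv ⊢
    · rw [hH.par_tgt e v hv]
    · rw [hK.par_tgt e v hv]
  · rintro (e | e) (e' | e') h <;> simp at h
    · exact hr _ _ h
    · exact hr' _ _ h
  · rintro (e | e) (e' | e') ⟨(v | v), hx, hx'⟩ <;> simp at hx hx'
    · exact hs _ _ ⟨v, hx, hx'⟩
    · exact hs' _ _ ⟨v, hx, hx'⟩
  · rintro (e | e)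
    · exact (hH.src_nodup e).map Sum.inl_injective
    · exact (hK.src_nodup e).map Sum.inr_injective
  · rintro (e | e) (e' | e') (v | v) hx hx' <;> simp at hx hx'
    · rw [hH.src_unique _ _ v hx hx']
    · rw [hK.src_unique _ _ v hx hx']
  · rintro (e | e)
    · exact (hH.tgt_nodup e).map Sum.inl_injective
    · exact (hK.tgt_nodup e).map Sum.inr_injective
  · rintro (e | e) (e' | e') (v | v) hx hx' <;> simp at hx hx'
    · rw [hH.tgt_unique _ _ v hx hx']
    · rw [hK.tgt_unique _ _ v hx hx']
  · rintro (_ | e | e)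
    · exact ((hH.inputs_nodup none).map Sum.inl_injective).append
        ((hK.inputs_nodup none).map Sum.inr_injective) (by simp [List.disjoint_left])
    · exact (hH.inputs_nodup (some e)).map Sum.inl_injective
    · exact (hK.inputs_nodup (some e)).map Sum.inr_injective
  · rintro (_ | e | e) (v | v) <;> simp [IsInput, hH.mem_inputs, hK.mem_inputs]
  · rintro (_ | e | e)
    · exact ((hH.outputs_nodup none).map Sum.inl_injective).append
        ((hK.outputs_nodup none).map Sum.inr_injective) (by simp [List.disjoint_left])
    · exact (hH.outputs_nodup (some e)).map Sum.inl_injective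
    · exact (hK.outputs_nodup (some e)).map Sum.inr_injective
  · rintro (_ | e | e) (v | v) <;> simp [IsOutput, hH.mem_outputs, hK.mem_outputs]
  · rintro (e | e) he
    · obtain ⟨h1, h2⟩ := hH.labelled_empty e he
      refine ⟨?_, ?_⟩
      · rintro (w | v) <;> simp [h1]
      · rintro (e' | e') <;> simp [h2]
    · obtain ⟨h1, h2⟩ := hK.labelled_empty e he
      refine ⟨?_, ?_⟩
      · rintro (w | v) <;> simp [h1]
      · rintro (e' | e') <;> simp [h2]

theorem wellTyped_tensor (hH : H.WellTyped) (hK : K.WellTyped) : (tensor H K).WellTyped := by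
  constructor
  · rintro (e | e) l he
    · simpa using hH.labelled e l he
    · simpa using hK.labelled e l he
  · rintro (e | e) he
    · simpa using hH.unlabelled e he
    · simpa using hK.unlabelled e he

theorem isHypernet_abs (Γ A C : Obj B) (hH : H.IsHypernet) : (abs Γ A C H).IsHypernet := by
  have := hH.finite_V
  have := hH.finite_E
  obtain ⟨r, hr⟩ := exists_height hH.par_acyclic
  obtain ⟨s, hs⟩ := exists_rank hH.acyclic
  refine
    { finite_V := inferInstanceAs (Finite ((Fin Γ.length ⊕ Unit) ⊕ H.V))
      finite_E := inferInstanceAs (Finite (Option H.E))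
      par_src := ?_
      par_tgt := ?_
      -- The new edge has height `0`, and everything that it contains is one step deeper.
      par_acyclic := par_acyclic_of_height (r := fun e => e.elim 0 (fun e => r e + 1)) ?_
      -- The rank of the new edge is arbitrary, as it neither precedes nor follows any edge.
      acyclic := acyclic_of_rank (r := fun e => e.elim 0 s) ?_
      src_nodup := ?_
      src_unique := ?_
      tgt_nodup := ?_
      tgt_unique := ?_
      inputs_nodup := ?_
      mem_inputs := ?_
      outputs_nodup := ?_
      mem_outputs := ?_
      labelled_empty := ?_ }
  · rintro (_ | e) ((v | v) | v) hv <;> simp at hv ⊢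
    · rw [hH.par_src e v hv]
  · rintro (_ | e) ((v | v) | v) hv <;> simp at hv ⊢
    · rw [hH.par_tgt e v hv]
  · rintro (_ | e) (_ | e') h <;> simp at h ⊢
    exact hr _ _ h
  · rintro (_ | e) (_ | e') ⟨((v | v) | v), hx, hx'⟩ <;> simp at hx hx' ⊢
    · exact hs _ _ ⟨v, hx, hx'⟩
  · rintro (_ | e)
    · exact (List.nodup_finRange _).map (Sum.inl_injective.comp Sum.inl_injective)
    · exact (hH.src_nodup e).map Sum.inr_injective
  · rintro (_ | e) (_ | e') ((v | v) | v) hx hx' <;> simp at hx hx' ⊢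
    · rw [hH.src_unique _ _ v hx hx']
  · rintro (_ | e)
    · simp
    · exact (hH.tgt_nodup e).map Sum.inr_injective
  · rintro (_ | e) (_ | e') ((v | v) | v) hx hx' <;> simp at hx hx' ⊢
    · rw [hH.tgt_unique _ _ v hx hx']
  · rintro (_ | e)
    · exact (List.nodup_finRange _).map (Sum.inl_injective.comp Sum.inl_injective)
    · exact (hH.inputs_nodup e).map Sum.inr_injective
  · rintro (_ | e) ((v | v) | v) <;>
      simp [IsInput, hH.mem_inputs, Option.forall]
  · rintro (_ | e)
    · simp
    · exact (hH.outputs_nodup e).map Sum.inr_injective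
  · rintro (_ | e) ((v | v) | v) <;>
      simp [IsOutput, hH.mem_outputs, Option.forall]
  · rintro (_ | e) he
    · simp at he
    · obtain ⟨h1, h2⟩ := hH.labelled_empty e he
      refine ⟨?_, ?_⟩
      · rintro ((v | v) | v) <;> simp [h1]
      · rintro (_ | e') <;> simp [h2]

theorem wellTyped_abs {Γ A C : Obj B} (hH : H.WellTyped) (hi : H.inTypes = Γ ++ A)
    (ho : H.outTypes = C) : (abs Γ A C H).WellTyped := by
  constructor
  · rintro (_ | e) l he
    · simp at he
    · simpa using hH.labelled e l he
  · rintro (_ | e) he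
    · refine ⟨A, ?_, ?_⟩
      · simpa [Function.comp_def, inTypes] using hi.symm
      · simpa [outTypes] using ho.symm
    · simpa using hH.unlabelled e he

theorem isHypernet_gen (l : Label Sg) : (gen l).IsHypernet := by
  refine
    { finite_V := inferInstanceAs (Finite (Fin _ ⊕ Fin _))
      finite_E := inferInstanceAs (Finite Unit)
      par_src := by simp
      par_tgt := by simp
      par_acyclic := par_acyclic_of_height (r := fun _ => 0) (by simp)
      acyclic := acyclic_of_rank (r := fun _ => 0) ?_
      src_nodup := fun _ => (List.nodup_finRange _).map Sum.inl_injective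
      src_unique := by simp
      tgt_nodup := fun _ => (List.nodup_finRange _).map Sum.inr_injective
      tgt_unique := by simp
      inputs_nodup := ?_
      mem_inputs := ?_
      outputs_nodup := ?_
      mem_outputs := ?_
      labelled_empty := by simp }
  · rintro _ _ ⟨(v | v), hx, hx'⟩ <;> simp at hx hx'
  · rintro (_ | _)
    · exact (List.nodup_finRange _).map Sum.inl_injective
    · simp
  · rintro (_ | _) (v | v) <;> simp [IsInput]
  · rintro (_ | _)
    · exact (List.nodup_finRange _).map Sum.inr_injective
    · simp
  · rintro (_ | _) (v | v) <;> simp [IsOutput]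

theorem wellTyped_gen (l : Label Sg) : (gen l).WellTyped := by
  constructor
  · rintro e l' he
    obtain rfl : l = l' := by simpa using he
    simp [Function.comp_def]
  · simp

theorem isHypernet_id (A : Obj B) : (id A : Net Sg).IsHypernet where
  finite_V := inferInstanceAs (Finite (Fin _))
  finite_E := inferInstanceAs (Finite Empty)
  par_src := nofun
  par_tgt := nofun
  par_acyclic := nofun
  acyclic := nofun
  src_nodup := nofun
  src_unique := nofun
  tgt_nodup := nofun
  tgt_unique := nofun
  inputs_nodup _ := List.nodup_finRange _
  mem_inputs := by rintro (_ | ⟨⟨⟩⟩) v; simp [IsInput]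
  outputs_nodup _ := List.nodup_finRange _
  mem_outputs := by rintro (_ | ⟨⟨⟩⟩) v; simp [IsOutput]
  labelled_empty := nofun

theorem isHypernet_swap (A C : Obj B) : (swap A C : Net Sg).IsHypernet where
  finite_V := inferInstanceAs (Finite (Fin _ ⊕ Fin _))
  finite_E := inferInstanceAs (Finite Empty)
  par_src := nofun
  par_tgt := nofun
  par_acyclic := nofun
  acyclic := nofun
  src_nodup := nofun
  src_unique := nofun
  tgt_nodup := nofun
  tgt_unique := nofun
  inputs_nodup _ := ((List.nodup_finRange _).map Sum.inl_injective).append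
    ((List.nodup_finRange _).map Sum.inr_injective) (by simp [List.disjoint_left])
  mem_inputs := by rintro (_ | ⟨⟨⟩⟩) (v | v) <;> simp [IsInput]
  outputs_nodup _ := ((List.nodup_finRange _).map Sum.inr_injective).append
    ((List.nodup_finRange _).map Sum.inl_injective) (by simp [List.disjoint_left])
  mem_outputs := by rintro (_ | ⟨⟨⟩⟩) (v | v) <;> simp [IsOutput]
  labelled_empty := nofun

end Net

open Net

/-- Diagrams are interpreted by well-typed hypernets with the same interface types. -/
theorem Diagram.interp_spec {A C : Obj B} (S : Diagram Sg A C) :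
    S.interp.IsHypernet ∧ S.interp.WellTyped ∧ S.interp.inTypes = A ∧ S.interp.outTypes = C := by
  induction S with
  | id A =>
    refine ⟨isHypernet_id A, ⟨nofun, nofun⟩, ?_, ?_⟩ <;> simp [interp, inTypes, outTypes]
  | gen l =>
    refine ⟨isHypernet_gen l, wellTyped_gen l, ?_, ?_⟩ <;>
      simp [interp, inTypes, outTypes, Function.comp_def]
  | swap A C =>
    refine ⟨isHypernet_swap A C, ⟨nofun, nofun⟩, ?_, ?_⟩ <;>
      simp [interp, inTypes, outTypes, Function.comp_def]
  | comp f g ihf ihg =>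
    obtain ⟨h1, h2, h3, h4⟩ := ihf
    obtain ⟨h1', h2', h3', h4'⟩ := ihg
    have hl := h3'.trans h4.symm
    refine ⟨isHypernet_comp h1 h1' hl, wellTyped_comp h2 h2' h1' hl, ?_, ?_⟩
    · simpa [interp, inTypes, Function.comp_def] using h3
    · refine Eq.trans ?_ h4'
      simp only [interp, outTypes, List.map_map]
      exact List.map_congr_left fun v _ => labV_glue h1' hl v
  | tensor f g ihf ihg =>
    obtain ⟨h1, h2, h3, h4⟩ := ihf
    obtain ⟨h1', h2', h3', h4'⟩ := ihg
    refine ⟨isHypernet_tensor h1 h1', wellTyped_tensor h2 h2', ?_, ?_⟩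
    · refine Eq.trans ?_ (congrArg₂ (· ++ ·) h3 h3')
      simp [interp, inTypes, Function.comp_def]
    · refine Eq.trans ?_ (congrArg₂ (· ++ ·) h4 h4')
      simp [interp, outTypes, Function.comp_def]
  | abs f ih =>
    obtain ⟨h1, h2, h3, h4⟩ := ih
    refine ⟨isHypernet_abs _ _ _ h1, wellTyped_abs h2 h3 h4, ?_, ?_⟩ <;>
      simp [interp, inTypes, outTypes, Function.comp_def]

/-! ### An interpretation has the shape of its diagram -/

namespace Net

variable {H K : Net Sg}

theorem IsLevel.map_of_injective {p : Option H.E} {q : Option K.E} {M : Multiset H.E}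
    (h : H.IsLevel p M) {σ : H.E → K.E} (hσ : σ.Injective)
    (hpq : ∀ x, K.parE x = q ↔ ∃ e, H.parE e = p ∧ σ e = x) : K.IsLevel q (M.map σ) :=
  ⟨h.1.map hσ, fun x => by simp [h.2, hpq]⟩

variable (H K) in
/-- The inclusion of the first hypernet into a sequential composition. -/
noncomputable def compInl : Hom H (comp H K) where
  onV := Sum.inl
  onE := Sum.inl
  src_eq _ := rfl
  tgt_eq _ := rfl
  labV_eq _ := rfl
  labE_eq _ := rfl
  inputs_eq _ := rfl
  outputs_eq _ := rfl
  level e M h := h.map_of_injective Sum.inl_injective (by rintro (x | x) <;> simp)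

/-- The map from the second hypernet into a sequential composition. -/
noncomputable def compGlue (hK : K.IsHypernet) (hl : K.inTypes = H.outTypes) :
    Hom K (comp H K) where
  onV := glue H K
  onE := Sum.inr
  src_eq _ := rfl
  tgt_eq _ := rfl
  labV_eq := labV_glue hK hl
  labE_eq _ := rfl
  inputs_eq _ := rfl
  outputs_eq _ := rfl
  level e M h := h.map_of_injective Sum.inr_injective (by rintro (x | x) <;> simp)

variable (H K) in
/-- The inclusion of the first hypernet into a parallel composition. -/
def tensorInl : Hom H (tensor H K) where
  onV := Sum.inl
  onE := Sum.inl
  src_eq _ := rfl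
  tgt_eq _ := rfl
  labV_eq _ := rfl
  labE_eq _ := rfl
  inputs_eq _ := rfl
  outputs_eq _ := rfl
  level e M h := h.map_of_injective Sum.inl_injective (by rintro (x | x) <;> simp)

variable (H K) in
/-- The inclusion of the second hypernet into a parallel composition. -/
def tensorInr : Hom K (tensor H K) where
  onV := Sum.inr
  onE := Sum.inr
  src_eq _ := rfl
  tgt_eq _ := rfl
  labV_eq _ := rfl
  labE_eq _ := rfl
  inputs_eq _ := rfl
  outputs_eq _ := rfl
  level e M h := h.map_of_injective Sum.inr_injective (by rintro (x | x) <;> simp)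

variable (H) in
/-- The inclusion of a hypernet into its abstraction. -/
def absInner (Γ A C : Obj B) : Hom H (abs Γ A C H) where
  onV := Sum.inr
  onE := some
  src_eq _ := rfl
  tgt_eq _ := rfl
  labV_eq _ := rfl
  labE_eq _ := rfl
  inputs_eq _ := rfl
  outputs_eq _ := rfl
  level e M h := h.map_of_injective (Option.some_injective _) (by rintro (_ | x) <;> simp)

theorem isLevel_gen (l : Label Sg) : (gen l).IsLevel none {()} :=
  ⟨by simp, by simp⟩

theorem isLevel_comp {M₁ : Multiset H.E} {M₂ : Multiset K.E} (h₁ : H.IsLevel none M₁)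
    (h₂ : K.IsLevel none M₂) :
    (comp H K).IsLevel none (M₁.map Sum.inl + M₂.map Sum.inr) := by
  refine ⟨Multiset.nodup_add.2 ⟨h₁.1.map Sum.inl_injective, h₂.1.map Sum.inr_injective, ?_⟩, ?_⟩
  · simp [Multiset.disjoint_left]
  · rintro (x | x) <;> simp [h₁.2, h₂.2]

theorem isLevel_tensor {M₁ : Multiset H.E} {M₂ : Multiset K.E} (h₁ : H.IsLevel none M₁)
    (h₂ : K.IsLevel none M₂) :
    (tensor H K).IsLevel none (M₁.map Sum.inl + M₂.map Sum.inr) := by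
  refine ⟨Multiset.nodup_add.2 ⟨h₁.1.map Sum.inl_injective, h₂.1.map Sum.inr_injective, ?_⟩, ?_⟩
  · simp [Multiset.disjoint_left]
  · rintro (x | x) <;> simp [h₁.2, h₂.2]

theorem isLevel_abs_none (Γ A C : Obj B) : (abs Γ A C H).IsLevel none {none} :=
  ⟨by simp, by rintro (_ | x) <;> simp⟩

theorem isLevel_abs_some {Γ A C : Obj B} {M : Multiset H.E} (h : H.IsLevel none M) :
    (abs Γ A C H).IsLevel (some none) (M.map some) :=
  h.map_of_injective (Option.some_injective _) (by rintro (_ | x) <;> simp)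

end Net

/-- The interpretation of a diagram has the shape of the diagram. -/
theorem Diagram.sat_interp {A C : Obj B} (S : Diagram Sg A C) {M : Multiset S.interp.E}
    (hM : S.interp.IsLevel none M) :
    S.Sat (S.interp.inputs none) (S.interp.outputs none) M := by
  induction S with
  | id A => exact ⟨rfl, by simp [interp], Multiset.eq_zero_of_forall_notMem nofun⟩
  | gen l =>
    refine ⟨(), hM.eq (isLevel_gen l), rfl, rfl, rfl, ?_, ?_⟩
    · simp [interp, Function.comp_def]
    · simp [interp, Function.comp_def]
  | swap A C =>
    refine ⟨_, _, rfl, rfl, ?_, ?_, Multiset.eq_zero_of_forall_notMem nofun⟩ <;>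
      simp [interp, Function.comp_def]
  | comp f g ihf ihg =>
    obtain ⟨hf, -, -, tf⟩ := f.interp_spec
    obtain ⟨hg, -, tg, -⟩ := g.interp_spec
    have hl := tg.trans tf.symm
    have := hf.finite_E
    have := hg.finite_E
    obtain ⟨M₁, h₁⟩ := exists_isLevel f.interp none
    obtain ⟨M₂, h₂⟩ := exists_isLevel g.interp none
    have h : g.Sat (H := Net.comp f.interp g.interp) ((g.interp.inputs none).map (glue _ _))
      ((g.interp.outputs none).map (glue _ _)) (M₂.map Sum.inr) := (compGlue hg hl).sat (ihg h₂)
    -- The glued inputs of the second net are the outputs of the first, so both factors meet in the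
    -- same intermediate list of wires.
    rw [map_glue_inputs hg hl] at h
    refine ⟨(f.interp.outputs none).map Sum.inl, _, _, (compInl f.interp g.interp).sat (ihf h₁), h,
      hM.eq (isLevel_comp h₁ h₂)⟩
  | tensor f g ihf ihg =>
    have := f.interp_spec.1.finite_E
    have := g.interp_spec.1.finite_E
    obtain ⟨M₁, h₁⟩ := exists_isLevel f.interp none
    obtain ⟨M₂, h₂⟩ := exists_isLevel g.interp none
    exact ⟨_, _, _, _, _, _, (tensorInl f.interp g.interp).sat (ihf h₁),
      (tensorInr f.interp g.interp).sat (ihg h₂), rfl, rfl, hM.eq (isLevel_tensor h₁ h₂)⟩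
  | @abs Γ A C f ih =>
    have := f.interp_spec.1.finite_E
    obtain ⟨M₁, h₁⟩ := exists_isLevel f.interp none
    refine ⟨none, M₁.map some, hM.eq (isLevel_abs_none ..), rfl, rfl, rfl, ?_, ?_,
      isLevel_abs_some h₁, (absInner f.interp Γ A C).sat (ih h₁)⟩
    · simp [interp, Function.comp_def]
    · simp [interp]

/-! ### From a shape to a homomorphism out of the interpretation -/

/-- The interface vertices of the basic nets are positions in a list of types, so a label-preserving
map out of them amounts to a list of vertices with these types. -/
theorem exists_map_finRange {V : Type*} {lab : V → Ty B} {Γ : List V} {A : Obj B}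
    (h : Γ.map lab = A) : ∃ f : Fin A.length → V, (List.finRange A.length).map f = Γ ∧
      ∀ i, lab (f i) = A.get i := by
  subst h
  refine ⟨fun i => Γ.get (i.cast (List.length_map _)), ?_, fun i => by simp⟩
  refine List.ext_getElem (by simp) fun n h1 h2 => by simp

namespace Net

variable {H K N : Net Sg}

/-- Since a labelled edge of a hypernet contains nothing, its inner interfaces and inner level are
empty, as they are in `gen l`. -/
theorem exists_hom_gen (hN : N.IsHypernet) {l : Label Sg} {e : N.E} (he : N.labE e = some l)
    (h₁ : (N.src e).map N.labV = l.dom) (h₂ : (N.tgt e).map N.labV = l.cod) :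
    ∃ φ : Hom (gen l) N, ((gen l).inputs none).map φ.onV = N.src e ∧
      ((gen l).outputs none).map φ.onV = N.tgt e ∧ ∀ x, φ.onE x = e := by
  obtain ⟨f, hf, hf'⟩ := exists_map_finRange h₁
  obtain ⟨g, hg, hg'⟩ := exists_map_finRange h₂
  obtain ⟨h3, h4⟩ := hN.labelled_empty e (by simp [he])
  have hs : N.src e = ((List.finRange l.dom.length).map Sum.inl).map (Sum.elim f g) := by
    rw [List.map_map, ← hf]
    rfl
  have ht : N.tgt e = ((List.finRange l.cod.length).map Sum.inr).map (Sum.elim f g) := by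
    rw [List.map_map, ← hg]
    rfl
  refine ⟨{ onV := Sum.elim f g
            onE := fun _ => e
            src_eq := fun _ => hs
            tgt_eq := fun _ => ht
            labV_eq := ?_
            labE_eq := fun _ => he
            inputs_eq := fun _ => ?_
            outputs_eq := fun _ => ?_
            level := fun e' M h => ?_ }, hs.symm, ht.symm, fun _ => rfl⟩
  · rintro (v | v)
    · exact hf' v
    · exact hg' v
  · exact List.eq_nil_iff_forall_not_mem.2 fun v hv => h3 v ((hN.mem_inputs _ v).1 hv).1
  · exact List.eq_nil_iff_forall_not_mem.2 fun v hv => h3 v ((hN.mem_outputs _ v).1 hv).1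
  · have : M = 0 := Multiset.eq_zero_of_forall_notMem fun x hx => by simpa using (h.2 x).1 hx
    subst this
    exact ⟨by simp, fun x => by simp [h4]⟩

/-- The universal property of the gluing, as in a pushout: `h` says that the two maps agree where
outputs of `H` are identified with inputs of `K`. -/
theorem exists_hom_comp (hH : H.IsHypernet) (hK : K.IsHypernet) (hl : K.inTypes = H.outTypes)
    (φ : Hom H N) (ψ : Hom K N)
    (h : (H.outputs none).map φ.onV = (K.inputs none).map ψ.onV) :
    ∃ χ : Hom (comp H K) N, (∀ v, χ.onV (Sum.inl v) = φ.onV v) ∧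
      (∀ v, χ.onV (glue H K v) = ψ.onV v) ∧ (∀ e, χ.onE (Sum.inl e) = φ.onE e) ∧
      (∀ e, χ.onE (Sum.inr e) = ψ.onE e) := by
  have := hH.finite_E
  have := hK.finite_E
  let χ : CompV H K → N.V := Sum.elim φ.onV fun v => ψ.onV v.1
  have hχ : ∀ v, χ (glue H K v) = ψ.onV v := by
    intro v
    by_cases hv : v ∈ K.inputs none
    · have : (K.inputs none).map (χ ∘ glue H K) = (K.inputs none).map ψ.onV := by
        rw [← List.map_map, map_glue_inputs hK hl, List.map_map]
        exact h
      exact List.map_inj_left.1 this v hv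
    · obtain ⟨_, hv⟩ := glue_not_mem (H := H) hv
      rw [hv]
      rfl
  have hχ' : ∀ l : List K.V, (l.map (glue H K)).map χ = l.map ψ.onV := by
    intro l
    rw [List.map_map]
    exact List.map_congr_left fun v _ => hχ v
  have hφ' : ∀ l : List H.V, (l.map Sum.inl).map χ = l.map φ.onV := by
    intro l
    rw [List.map_map]
    rfl
  refine ⟨{ onV := χ
            onE := Sum.elim φ.onE ψ.onE
            src_eq := ?_
            tgt_eq := ?_
            labV_eq := ?_
            labE_eq := ?_
            inputs_eq := ?_
            outputs_eq := ?_
            level := ?_ }, fun _ => rfl, hχ, fun _ => rfl, fun _ => rfl⟩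
  · rintro (e | e)
    · exact (φ.src_eq e).trans (hφ' _).symm
    · exact (ψ.src_eq e).trans (hχ' _).symm
  · rintro (e | e)
    · exact (φ.tgt_eq e).trans (hφ' _).symm
    · exact (ψ.tgt_eq e).trans (hχ' _).symm
  · rintro (v | v)
    · exact φ.labV_eq v
    · exact ψ.labV_eq v.1
  · rintro (e | e)
    · exact φ.labE_eq e
    · exact ψ.labE_eq e
  · rintro (e | e)
    · exact (φ.inputs_eq e).trans (hφ' _).symm
    · exact (ψ.inputs_eq e).trans (hχ' _).symm
  · rintro (e | e)
    · exact (φ.outputs_eq e).trans (hφ' _).symm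
    · exact (ψ.outputs_eq e).trans (hχ' _).symm
  · rintro (e | e) M hM
    · obtain ⟨M', hM'⟩ := exists_isLevel H (some e)
      obtain rfl := hM.eq ((compInl H K).level e M' hM')
      rw [Multiset.map_map]
      exact φ.level e M' hM'
    · obtain ⟨M', hM'⟩ := exists_isLevel K (some e)
      obtain rfl := hM.eq ((compGlue hK hl).level e M' hM')
      rw [Multiset.map_map]
      exact ψ.level e M' hM'

theorem exists_hom_tensor (hH : H.IsHypernet) (hK : K.IsHypernet) (φ : Hom H N) (ψ : Hom K N) :
    ∃ χ : Hom (tensor H K) N, χ.onV = Sum.elim φ.onV ψ.onV ∧ χ.onE = Sum.elim φ.onE ψ.onE := by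
  have := hH.finite_E
  have := hK.finite_E
  have hψ' : ∀ l : List K.V, (l.map Sum.inr).map (Sum.elim φ.onV ψ.onV) = l.map ψ.onV := by
    intro l
    rw [List.map_map]
    rfl
  have hφ' : ∀ l : List H.V, (l.map Sum.inl).map (Sum.elim φ.onV ψ.onV) = l.map φ.onV := by
    intro l
    rw [List.map_map]
    rfl
  refine ⟨{ onV := Sum.elim φ.onV ψ.onV
            onE := Sum.elim φ.onE ψ.onE
            src_eq := ?_
            tgt_eq := ?_
            labV_eq := ?_
            labE_eq := ?_
            inputs_eq := ?_
            outputs_eq := ?_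
            level := ?_ }, rfl, rfl⟩
  · rintro (e | e)
    · exact (φ.src_eq e).trans (hφ' _).symm
    · exact (ψ.src_eq e).trans (hψ' _).symm
  · rintro (e | e)
    · exact (φ.tgt_eq e).trans (hφ' _).symm
    · exact (ψ.tgt_eq e).trans (hψ' _).symm
  · rintro (v | v)
    · exact φ.labV_eq v
    · exact ψ.labV_eq v
  · rintro (e | e)
    · exact φ.labE_eq e
    · exact ψ.labE_eq e
  · rintro (e | e)
    · exact (φ.inputs_eq e).trans (hφ' _).symm
    · exact (ψ.inputs_eq e).trans (hψ' _).symm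
  · rintro (e | e)
    · exact (φ.outputs_eq e).trans (hφ' _).symm
    · exact (ψ.outputs_eq e).trans (hψ' _).symm
  · rintro (e | e) M hM
    · obtain ⟨M', hM'⟩ := exists_isLevel H (some e)
      obtain rfl := hM.eq ((tensorInl H K).level e M' hM')
      rw [Multiset.map_map]
      exact φ.level e M' hM'
    · obtain ⟨M', hM'⟩ := exists_isLevel K (some e)
      obtain rfl := hM.eq ((tensorInr H K).level e M' hM')
      rw [Multiset.map_map]
      exact ψ.level e M' hM'

/-- The outermost level of `H` becomes the inside of the new edge. A homomorphism puts no condition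
on that level, so its interfaces and its edges are controlled by `hi`, `ho` and `hM`. -/
theorem exists_hom_abs (hH : H.IsHypernet) {Γ A C : Obj B} {e : N.E} (he : N.labE e = none)
    (h₁ : (N.src e).map N.labV = Γ) (h₂ : (N.tgt e).map N.labV = [Ty.lolly A C]) (φ : Hom H N)
    (hi : (H.inputs none).map φ.onV = N.inputs (some e))
    (ho : (H.outputs none).map φ.onV = N.outputs (some e))
    (hM : ∀ M, H.IsLevel none M → N.IsLevel (some e) (M.map φ.onE)) :
    ∃ χ : Hom (abs Γ A C H) N, ((abs Γ A C H).inputs none).map χ.onV = N.src e ∧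
      ((abs Γ A C H).outputs none).map χ.onV = N.tgt e ∧ χ.onE none = e := by
  have := hH.finite_E
  obtain ⟨f, hf, hf'⟩ := exists_map_finRange h₁
  obtain ⟨t, ht, ht'⟩ := List.map_eq_singleton_iff.1 h₂
  let χ : (Fin Γ.length ⊕ Unit) ⊕ H.V → N.V := Sum.elim (Sum.elim f fun _ => t) φ.onV
  have hs : N.src e = ((List.finRange Γ.length).map
      (fun i => (Sum.inl (Sum.inl i) : (Fin Γ.length ⊕ Unit) ⊕ H.V))).map χ := by
    rw [List.map_map, ← hf]
    rfl
  have hφ' : ∀ l : List H.V, (l.map Sum.inr).map χ = l.map φ.onV := by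
    intro l
    rw [List.map_map]
    rfl
  refine ⟨{ onV := χ
            onE := fun x => x.elim e φ.onE
            src_eq := ?_
            tgt_eq := ?_
            labV_eq := ?_
            labE_eq := ?_
            inputs_eq := ?_
            outputs_eq := ?_
            level := ?_ }, hs.symm, ht.symm, rfl⟩
  · rintro (_ | e)
    · exact hs
    · exact (φ.src_eq e).trans (hφ' _).symm
  · rintro (_ | e)
    · exact ht
    · exact (φ.tgt_eq e).trans (hφ' _).symm
  · rintro ((v | v) | v)
    · exact hf' v
    · exact ht'
    · exact φ.labV_eq v
  · rintro (_ | e)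
    · exact he
    · exact φ.labE_eq e
  · rintro (_ | e)
    · exact hi.symm.trans (hφ' _).symm
    · exact (φ.inputs_eq e).trans (hφ' _).symm
  · rintro (_ | e)
    · exact ho.symm.trans (hφ' _).symm
    · exact (φ.outputs_eq e).trans (hφ' _).symm
  · rintro (_ | e) M hM₀
    · obtain ⟨M', hM'⟩ := exists_isLevel H none
      obtain rfl := hM₀.eq (isLevel_abs_some hM')
      rw [Multiset.map_map]
      exact hM M' hM'
    · obtain ⟨M', hM'⟩ := exists_isLevel H (some e)
      obtain rfl := hM₀.eq ((absInner H Γ A C).level e M' hM')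
      rw [Multiset.map_map]
      exact φ.level e M' hM'

end Net

/-- A part of a hypernet that has the shape of a diagram is an image of its interpretation. -/
theorem Diagram.Sat.exists_hom {N : Net Sg} (hN : N.IsHypernet) {A C : Obj B}
    {S : Diagram Sg A C} {Γ out : List N.V} {M : Multiset N.E} (h : S.Sat Γ out M) :
    ∃ φ : Hom S.interp N, (S.interp.inputs none).map φ.onV = Γ ∧
      (S.interp.outputs none).map φ.onV = out ∧
      ∀ M₀, S.interp.IsLevel none M₀ → M₀.map φ.onE = M := by
  induction S generalizing Γ out M with
  | id A =>
    obtain ⟨rfl, h, rfl⟩ := h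
    obtain ⟨f, hf, hf'⟩ := exists_map_finRange h
    exact ⟨⟨f, Empty.elim, nofun, nofun, hf', nofun, nofun, nofun, nofun⟩, hf, hf,
      fun M₀ _ => by rw [Multiset.eq_zero_of_forall_notMem (s := M₀) nofun, Multiset.map_zero]⟩
  | gen l =>
    obtain ⟨e, rfl, he, rfl, rfl, h₁, h₂⟩ := h
    obtain ⟨φ, hi, ho, hφ⟩ := exists_hom_gen hN he h₁ h₂
    refine ⟨φ, hi, ho, fun M₀ h => ?_⟩
    rw [h.eq (isLevel_gen l)]
    exact congrArg (fun x => ({x} : Multiset N.E)) (hφ ())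
  | swap A C =>
    obtain ⟨Γ₁, Γ₂, rfl, rfl, h₁, h₂, rfl⟩ := h
    obtain ⟨f, hf, hf'⟩ := exists_map_finRange h₁
    obtain ⟨g, hg, hg'⟩ := exists_map_finRange h₂
    refine ⟨⟨Sum.elim f g, Empty.elim, nofun, nofun, ?_, nofun, nofun, nofun, nofun⟩, ?_, ?_,
      fun M₀ _ => by rw [Multiset.eq_zero_of_forall_notMem (s := M₀) nofun, Multiset.map_zero]⟩
    · rintro (v | v)
      · exact hf' v
      · exact hg' v
    · simp [interp, hf, hg]
    · simp [interp, hf, hg]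
  | comp f g ihf ihg =>
    obtain ⟨Θ, M₁, M₂, hf, hg, rfl⟩ := h
    obtain ⟨φ, hi, ho, hφ⟩ := ihf hf
    obtain ⟨ψ, hi', ho', hψ⟩ := ihg hg
    obtain ⟨hf, -, -, tf⟩ := f.interp_spec
    obtain ⟨hg, -, tg, -⟩ := g.interp_spec
    have hl := tg.trans tf.symm
    have := hf.finite_E
    have := hg.finite_E
    obtain ⟨χ, h1, h2, h3, h4⟩ := exists_hom_comp hf hg hl φ ψ (ho.trans hi'.symm)
    refine ⟨χ, ?_, ?_, fun M₀ h => ?_⟩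
    · rw [← hi]
      simp [interp, h1]
    · rw [← ho']
      simp [interp, h2]
    · obtain ⟨N₁, h₁⟩ := exists_isLevel f.interp none
      obtain ⟨N₂, h₂⟩ := exists_isLevel g.interp none
      rw [h.eq (isLevel_comp h₁ h₂), ← hφ _ h₁, ← hψ _ h₂]
      refine (Multiset.map_add ..).trans (congrArg₂ (· + ·) ?_ ?_)
      · exact (Multiset.map_map ..).trans (Multiset.map_congr rfl fun e _ => h3 e)
      · exact (Multiset.map_map ..).trans (Multiset.map_congr rfl fun e _ => h4 e)
  | tensor f g ihf ihg =>
    obtain ⟨Γ₁, Γ₂, out₁, out₂, M₁, M₂, hf, hg, rfl, rfl, rfl⟩ := h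
    obtain ⟨φ, hi, ho, hφ⟩ := ihf hf
    obtain ⟨ψ, hi', ho', hψ⟩ := ihg hg
    have hf := f.interp_spec.1
    have hg := g.interp_spec.1
    have := hf.finite_E
    have := hg.finite_E
    obtain ⟨χ, h1, h2⟩ := exists_hom_tensor hf hg φ ψ
    refine ⟨χ, ?_, ?_, fun M₀ h => ?_⟩
    · rw [← hi, ← hi']
      simp [interp, h1]
    · rw [← ho, ← ho']
      simp [interp, h1]
    · obtain ⟨N₁, h₁⟩ := exists_isLevel f.interp none
      obtain ⟨N₂, h₂⟩ := exists_isLevel g.interp none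
      rw [h.eq (isLevel_tensor h₁ h₂), ← hφ _ h₁, ← hψ _ h₂, h2]
      exact (Multiset.map_add ..).trans
        (congrArg₂ (· + ·) (Multiset.map_map ..) (Multiset.map_map ..))
  | abs f ih =>
    obtain ⟨e, M', rfl, he, rfl, rfl, h₁, h₂, h₃, hf⟩ := h
    obtain ⟨φ, hi, ho, hφ⟩ := ih hf
    obtain ⟨χ, h1, h2, h3⟩ := exists_hom_abs f.interp_spec.1 he h₁ h₂ φ hi ho
      fun M hM => (hφ M hM).symm ▸ h₃
    refine ⟨χ, h1, h2, fun M₀ h => ?_⟩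
    rw [h.eq (isLevel_abs_none ..)]
    exact congrArg (fun x => ({x} : Multiset N.E)) h3

/-! ### Homomorphisms that are isomorphisms -/

namespace Net

variable {H K : Net Sg}

/-- A homomorphism of hypernets that preserves the outermost interfaces and is bijective on the
outermost edges is an isomorphism. -/
theorem Hom.isomorphic (hH : H.IsHypernet) (hK : K.IsHypernet) (φ : Hom H K)
    (hi : K.inputs none = (H.inputs none).map φ.onV)
    (ho : K.outputs none = (H.outputs none).map φ.onV)
    (hM : ∀ M, H.IsLevel none M → K.IsLevel none (M.map φ.onE)) : Isomorphic H K := by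
  have := hH.finite_E
  have hi' : ∀ p : Option H.E, K.inputs (p.map φ.onE) = (H.inputs p).map φ.onV := by
    rintro (_ | e)
    exacts [hi, φ.inputs_eq e]
  have ho' : ∀ p : Option H.E, K.outputs (p.map φ.onE) = (H.outputs p).map φ.onV := by
    rintro (_ | e)
    exacts [ho, φ.outputs_eq e]
  have hM' : ∀ (p : Option H.E) M, H.IsLevel p M → K.IsLevel (p.map φ.onE) (M.map φ.onE) := by
    rintro (_ | e)
    exacts [hM, φ.level e]
  -- An edge belongs to the level of its parent, and that whole level is mapped to the corresponding
  -- level of `K`.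
  have hparE : ∀ e, K.parE (φ.onE e) = (H.parE e).map φ.onE := by
    intro e
    obtain ⟨M, h⟩ := exists_isLevel H (H.parE e)
    exact ((hM' _ M h).2 _).1 (Multiset.mem_map_of_mem _ ((h.2 e).2 rfl))
  -- Induction on the height: edges with the same image have parents with the same image, hence the
  -- same parent, and within one level the map is injective. Surjectivity is proved in the same way,
  -- starting from a preimage of the parent.
  have hinjE : φ.onE.Injective := by
    obtain ⟨r, hr⟩ := exists_height hH.par_acyclic
    intro e
    induction hn : r e using Nat.strong_induction_on generalizing e with
    | _ n ih =>
    intro e' hee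
    have hp : H.parE e = H.parE e' := by
      have h := congrArg K.parE hee
      rw [hparE, hparE] at h
      cases h1 : H.parE e with
      | none => cases h2 : H.parE e' with
        | none => rfl
        | some b => simp [h1, h2] at h
      | some a => cases h2 : H.parE e' with
        | none => simp [h1, h2] at h
        | some b =>
          have hab : φ.onE a = φ.onE b := by simpa [h1, h2] using h
          rw [ih _ (hn ▸ hr e a h1) rfl hab]
    obtain ⟨M, h⟩ := exists_isLevel H (H.parE e)
    exact Multiset.inj_on_of_nodup_map (hM' _ M h).1 e ((h.2 e).2 rfl) e' ((h.2 e').2 hp.symm) hee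
  have hsurjE : φ.onE.Surjective := by
    obtain ⟨r, hr⟩ := exists_height hK.par_acyclic
    intro x
    induction hn : r x using Nat.strong_induction_on generalizing x with
    | _ n ih =>
    obtain ⟨p, hp⟩ : ∃ p : Option H.E, K.parE x = p.map φ.onE := by
      cases h : K.parE x with
      | none => exact ⟨none, rfl⟩
      | some y =>
        obtain ⟨e, rfl⟩ := ih _ (hn ▸ hr x y h) y rfl
        exact ⟨some e, rfl⟩
    obtain ⟨M, h⟩ := exists_isLevel H p
    obtain ⟨e, -, he⟩ := Multiset.mem_map.1 (((hM' _ M h).2 x).2 hp)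
    exact ⟨e, he⟩
  -- Every vertex is either an input of its level or a target of a unique edge, so bijectivity on
  -- vertices reduces to that on edges.
  have hV : ∀ v : H.V, v ∈ H.inputs (H.parV v) ∨ ∃ e, v ∈ H.tgt e := by
    intro v
    by_cases h : ∃ e, v ∈ H.tgt e
    · exact .inr h
    · exact .inl ((hH.mem_inputs _ _).2 ⟨rfl, fun e he => h ⟨e, he⟩⟩)
  have hin : ∀ {p v}, v ∈ H.inputs p → φ.onV v ∈ K.inputs (p.map φ.onE) := by
    intro p v hv
    rw [hi']
    exact List.mem_map_of_mem hv
  have htgt : ∀ {e v}, v ∈ H.tgt e → φ.onV v ∈ K.tgt (φ.onE e) := by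
    intro e v hv
    rw [φ.tgt_eq]
    exact List.mem_map_of_mem hv
  have hparV : ∀ v, K.parV (φ.onV v) = (H.parV v).map φ.onE := by
    intro v
    rcases hV v with h | ⟨e, h⟩
    · exact ((hK.mem_inputs _ _).1 (hin h)).1
    · rw [hK.par_tgt _ _ (htgt h), hparE, hH.par_tgt e v h]
  have hinjV : φ.onV.Injective := by
    intro v v' hvv
    rcases hV v with h | ⟨e, h⟩ <;> rcases hV v' with h' | ⟨e', h'⟩
    · have hp : H.parV v = H.parV v' := by
        refine Option.map_injective hinjE ?_
        rw [← hparV, ← hparV, hvv]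
      rw [← hp] at h'
      refine List.inj_on_of_nodup_map ?_ h h' hvv
      rw [← hi']
      exact hK.inputs_nodup _
    · exact absurd (hvv ▸ htgt h') (inputs_disjoint_tgt hK (hin h) _)
    · exact absurd (hvv ▸ htgt h) (inputs_disjoint_tgt hK (hin h') _)
    · obtain rfl : e = e' := hinjE (hK.tgt_unique _ _ _ (htgt h) (hvv ▸ htgt h'))
      refine List.inj_on_of_nodup_map ?_ h h' hvv
      rw [← φ.tgt_eq]
      exact hK.tgt_nodup _
  have hsurjV : φ.onV.Surjective := by
    intro x
    by_cases h : ∃ y, x ∈ K.tgt y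
    · obtain ⟨y, hy⟩ := h
      obtain ⟨e, rfl⟩ := hsurjE y
      rw [φ.tgt_eq] at hy
      obtain ⟨v, -, hv⟩ := List.mem_map.1 hy
      exact ⟨v, hv⟩
    · obtain ⟨p, hp⟩ : ∃ p : Option H.E, p.map φ.onE = K.parV x := by
        cases K.parV x with
        | none => exact ⟨none, rfl⟩
        | some y =>
          obtain ⟨e, rfl⟩ := hsurjE y
          exact ⟨some e, rfl⟩
      have hx := (hK.mem_inputs (K.parV x) x).2 ⟨rfl, fun y hy => h ⟨y, hy⟩⟩
      rw [← hp, hi'] at hx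
      obtain ⟨v, -, hv⟩ := List.mem_map.1 hx
      exact ⟨v, hv⟩
  exact ⟨{ onV := Equiv.ofBijective _ ⟨hinjV, hsurjV⟩
           onE := Equiv.ofBijective _ ⟨hinjE, hsurjE⟩
           src_eq := φ.src_eq
           tgt_eq := φ.tgt_eq
           labV_eq := φ.labV_eq
           labE_eq := φ.labE_eq
           parV_eq := hparV
           parE_eq := hparE
           inputs_eq := hi'
           outputs_eq := ho' }⟩

theorem Run.mem_right [DecidableEq H.V] {d : H.E → Mor Sg} {Γ out : List H.V} {L : List H.E}
    {m : Mor Sg} (h : H.Run d Γ L out m) {v : H.V} (hv : v ∈ out) :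
    v ∈ Γ ∨ ∃ e ∈ L, v ∈ H.tgt e := by
  induction h with
  | nil _ h => exact .inl (h.symm.subset hv)
  | cons _ h _ _ _ ih =>
    rcases ih hv with h' | ⟨e, he, h'⟩
    · rcases List.mem_append.1 h' with h' | h'
      · exact .inr ⟨_, List.mem_cons_self .., h'⟩
      · exact .inl (h.symm.subset (List.mem_append_right _ h'))
    · exact .inr ⟨e, List.mem_cons_of_mem _ he, h'⟩

theorem Run.single [DecidableEq H.V] (hH : H.IsHypernet) {d : H.E → Mor Sg} {e : H.E}
    (h₁ : (d e).dom = (H.src e).map H.labV) (h₂ : (d e).cod = (H.tgt e).map H.labV) :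
    H.Run d (H.src e) [e] (H.tgt e) (d e) := by
  have := Run.cons (Δ := []) (hH.src_nodup e) (by simp) h₁ h₂
    (.nil (by simpa using hH.tgt_nodup e) (by simp) : H.Run d _ [] (H.tgt e) _)
  simpa [Mor.id_nil, h₁, h₂, Mor.id_comp, Mor.comp_id] using this

end Net

/-! ### From shapes to runs, and completeness -/

namespace Diagram

/-- Generators and abstractions, that is, the diagrams of a single outermost edge. -/
def IsAtomic : ∀ {A C : Obj B}, Diagram Sg A C → Prop
  | _, _, .gen _ => True
  | _, _, .abs _ => True
  | _, _, _ => False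

variable {H : Net Sg} {A C : Obj B} {Γ out : List H.V} {M : Multiset H.E}

/-- A shape decomposes into single edges; this supplies the morphism by which each of them is
interpreted in a run. -/
theorem Sat.exists_atomic {f : Diagram Sg A C} (h : f.Sat Γ out M) {e : H.E} (he : e ∈ M) :
    ∃ (A' C' : Obj B) (g : Diagram Sg A' C'), g.IsAtomic ∧ g.Sat (H.src e) (H.tgt e) {e} := by
  induction f generalizing Γ out M with
  | id A =>
    obtain ⟨-, -, rfl⟩ := h
    simp at he
  | gen l =>
    obtain ⟨e', rfl, h, rfl, rfl, h'⟩ := h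
    obtain rfl := Multiset.mem_singleton.1 he
    exact ⟨_, _, .gen l, trivial, e, rfl, h, rfl, rfl, h'⟩
  | swap A C =>
    obtain ⟨_, _, -, -, -, -, rfl⟩ := h
    simp at he
  | comp f g ihf ihg =>
    obtain ⟨Θ, M₁, M₂, hf, hg, rfl⟩ := h
    rcases Multiset.mem_add.1 he with he | he
    exacts [ihf hf he, ihg hg he]
  | tensor f g ihf ihg =>
    obtain ⟨Γ₁, Γ₂, out₁, out₂, M₁, M₂, hf, hg, -, -, rfl⟩ := h
    rcases Multiset.mem_add.1 he with he | he
    exacts [ihf hf he, ihg hg he]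
  | abs f ih =>
    obtain ⟨e', M', rfl, h, rfl, rfl, h'⟩ := h
    obtain rfl := Multiset.mem_singleton.1 he
    exact ⟨_, _, .abs f, trivial, e, M', rfl, h, rfl, rfl, h'⟩

/-- A diagram is the composite of the edges of a part of a hypernet that has its shape. -/
theorem Sat.exists_run (hH : H.IsHypernet) [DecidableEq H.V] {d : H.E → Mor Sg}
    {f : Diagram Sg A C} (h : f.Sat Γ out M)
    (hd : ∀ e ∈ M, ∀ (A' C' : Obj B) (g : Diagram Sg A' C'), g.IsAtomic →
      g.Sat (H.src e) (H.tgt e) {e} → g.toMor = d e)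
    (hΓ : Γ.Nodup) (hM : M.Nodup) (hfresh : ∀ v ∈ Γ, ∀ e ∈ M, v ∉ H.tgt e) :
    ∃ L : List H.E, (L : Multiset H.E) = M ∧ H.Run d Γ L out f.toMor := by
  have single : ∀ {A C : Obj B} {g : Diagram Sg A C} {e : H.E}, g.toMor = d e →
      g.Sat (H.src e) (H.tgt e) {e} → H.Run d (H.src e) [e] (H.tgt e) g.toMor := by
    intro A C g e hg hs
    obtain ⟨h1, h2⟩ := hs.types
    rw [hg]
    exact .single hH (by rw [← hg, h1]; rfl) (by rw [← hg, h2]; rfl)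
  induction f generalizing Γ out M with
  | id A =>
    obtain ⟨rfl, rfl, rfl⟩ := h
    refine ⟨[], rfl, ?_⟩
    have := Run.nil (d := d) hΓ (.refl _)
    rwa [perm_self] at this
  | gen l =>
    have hs := h
    obtain ⟨e, rfl, -, rfl, rfl, -⟩ := h
    exact ⟨[e], rfl, single (hd e (by simp) _ _ _ trivial hs) hs⟩
  | swap A C =>
    obtain ⟨Γ₁, Γ₂, rfl, rfl, rfl, rfl, rfl⟩ := h
    refine ⟨[], rfl, ?_⟩
    have := Run.nil (d := d) hΓ (List.perm_append_comm (l₁ := Γ₁) (l₂ := Γ₂))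
    rwa [perm_swap hΓ] at this
  | comp f g ihf ihg =>
    obtain ⟨Θ, M₁, M₂, hf, hg, rfl⟩ := h
    rw [Multiset.nodup_add] at hM
    obtain ⟨L₁, rfl, h₁⟩ := ihf hf (fun e he => hd e (Multiset.mem_add.2 (.inl he))) hΓ hM.1
      fun v hv e he => hfresh v hv e (Multiset.mem_add.2 (.inl he))
    -- A wire in the middle is either an original one or a target of an edge of `M₁`. In neither
    -- case is it a target of an edge of `M₂`, because targets are unique and `M₁`, `M₂` are
    -- disjoint.
    obtain ⟨L₂, rfl, h₂⟩ := ihg hg (fun e he => hd e (Multiset.mem_add.2 (.inr he)))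
      h₁.nodup_right hM.2.1 fun v hv e he hve => by
        rcases h₁.mem_right hv with hv | ⟨e', he', hv⟩
        · exact hfresh v hv e (Multiset.mem_add.2 (.inr he)) hve
        · obtain rfl := hH.tgt_unique _ _ _ hv hve
          exact Multiset.disjoint_left.1 hM.2.2 (Multiset.mem_coe.2 he') he
    exact ⟨L₁ ++ L₂, rfl, Mor.toMor_comp f g ▸ h₁.append h₂⟩
  | tensor f g ihf ihg =>
    obtain ⟨Γ₁, Γ₂, out₁, out₂, M₁, M₂, hf, hg, rfl, rfl, rfl⟩ := h
    rw [Multiset.nodup_add] at hM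
    have hΓ' := List.nodup_append.1 hΓ
    obtain ⟨L₁, rfl, h₁⟩ := ihf hf (fun e he => hd e (Multiset.mem_add.2 (.inl he))) hΓ'.1 hM.1
      fun v hv e he => hfresh v (List.mem_append_left _ hv) e (Multiset.mem_add.2 (.inl he))
    obtain ⟨L₂, rfl, h₂⟩ := ihg hg (fun e he => hd e (Multiset.mem_add.2 (.inr he))) hΓ'.2.1 hM.2.1
      fun v hv e he => hfresh v (List.mem_append_right _ hv) e (Multiset.mem_add.2 (.inr he))
    -- A tensor product is run in two stages: first `f` beside the idle inputs of `g`, then `g`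
    -- beside the outputs of `f`.
    have h₁' := h₁.mul_id hΓ fun e he v hv hv' =>
      hfresh v (List.mem_append_right _ hv') e (Multiset.mem_add.2 (.inl he)) hv
    have h₂' := h₂.id_mul h₁'.nodup_right fun e he v hv hv' => by
      rcases h₁.mem_right hv' with hv' | ⟨e', he', hv'⟩
      · exact hfresh v (List.mem_append_left _ hv') e (Multiset.mem_add.2 (.inr he)) hv
      · obtain rfl := hH.tgt_unique _ _ _ hv' hv
        exact Multiset.disjoint_left.1 hM.2.2 (Multiset.mem_coe.2 he') he
    refine ⟨L₁ ++ L₂, rfl, ?_⟩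
    rw [Mor.toMor_tensor, Mor.mul_eq_left_right, h₂.dom_eq, h₁.cod_eq]
    exact h₁'.append h₂'
  | abs f ih =>
    have hs := h
    obtain ⟨e, M', rfl, -, rfl, rfl, -⟩ := h
    exact ⟨[e], rfl, single (hd e (by simp) _ _ _ trivial hs) hs⟩

/-- Diagrams of the shape of the same part of a hypernet are equal, if this holds for the parts
that consist of a single edge. -/
theorem Sat.toMor_eq (hH : H.IsHypernet) {A' C' : Obj B} {f : Diagram Sg A C}
    {f' : Diagram Sg A' C'} (h : f.Sat Γ out M) (h' : f'.Sat Γ out M)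
    (hM : ∀ e ∈ M, ∀ (A A' C C' : Obj B) (g : Diagram Sg A C) (g' : Diagram Sg A' C'),
      g.IsAtomic → g'.IsAtomic → g.Sat (H.src e) (H.tgt e) {e} →
      g'.Sat (H.src e) (H.tgt e) {e} → g.toMor = g'.toMor)
    (hΓ : Γ.Nodup) (hn : M.Nodup) (hfresh : ∀ v ∈ Γ, ∀ e ∈ M, v ∉ H.tgt e) :
    f.toMor = f'.toMor := by
  classical
  -- An edge is interpreted by the class of any atomic diagram of its shape; by `hM` the choice does
  -- not matter. Both diagrams then give runs for the same interpretation `d`.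
  have : ∀ e, ∃ m, e ∈ M → ∀ (A' C' : Obj B) (g : Diagram Sg A' C'), g.IsAtomic →
      g.Sat (H.src e) (H.tgt e) {e} → g.toMor = m := by
    intro e
    by_cases he : e ∈ M
    · obtain ⟨A₀, C₀, g₀, ha, hs⟩ := h.exists_atomic he
      exact ⟨g₀.toMor, fun he _ _ g hg hgs => hM e he _ _ _ _ g g₀ hg ha hgs hs⟩
    · exact ⟨1, fun h => absurd h he⟩
  choose d hd using this
  obtain ⟨L, rfl, hr⟩ := h.exists_run hH hd hΓ hn hfresh
  obtain ⟨L', hL, hr'⟩ := h'.exists_run hH hd hΓ hn hfresh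
  exact hr.unique hH hr' (Multiset.coe_eq_coe.1 hL).symm (Multiset.coe_nodup.1 hn) hfresh

end Diagram

/-- Induction on the edges of a hypernet, from the inside to the outside. -/
theorem Net.IsHypernet.edge_induction {H : Net Sg} (hH : H.IsHypernet) {P : H.E → Prop}
    (ih : ∀ e, (∀ e', H.parE e' = some e → P e') → P e) (e : H.E) : P e := by
  have := hH.finite_E
  obtain ⟨r, hr⟩ := exists_height hH.par_acyclic
  obtain ⟨N, hN⟩ := (Set.finite_range r).bddAbove
  have hN : ∀ e, r e ≤ N := fun e => hN ⟨e, rfl⟩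
  -- Heights grow towards the inside, so the induction is on the distance from an upper bound.
  induction hn : N - r e using Nat.strong_induction_on generalizing e with
  | _ n ih' =>
    refine ih e fun e' he' => ih' _ ?_ e' rfl
    have := hr _ _ he'
    have := hN e'
    omega

namespace Diagram

variable {H : Net Sg} {A C A' C' : Obj B}

/-- The label of the edge decides between a generator, which it determines, and an abstraction. The
bodies of two abstractions have the shape of the same inner level, whose edges are covered by the
induction, so they agree by `Sat.toMor_eq`. -/
theorem IsAtomic.toMor_eq (hH : H.IsHypernet) (e : H.E) : ∀ (A A' C C' : Obj B)
    (g : Diagram Sg A C) (g' : Diagram Sg A' C'), g.IsAtomic → g'.IsAtomic →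
    g.Sat (H.src e) (H.tgt e) {e} → g'.Sat (H.src e) (H.tgt e) {e} → g.toMor = g'.toMor := by
  induction e using hH.edge_induction with
  | _ e ih =>
  intro A A' C C' g g' hg hg' hs hs'
  cases g with
  | gen l =>
    obtain ⟨e₁, he, h₁, -⟩ := hs
    obtain rfl := Multiset.singleton_inj.1 he
    cases g' with
    | gen l' =>
      obtain ⟨e₁, he, h₂, -⟩ := hs'
      obtain rfl := Multiset.singleton_inj.1 he
      obtain rfl : l = l' := by simpa [h₁] using h₂
      rfl
    | abs f' =>
      obtain ⟨e₁, _, he, h₂, -⟩ := hs'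
      obtain rfl := Multiset.singleton_inj.1 he
      simp [h₁] at h₂
    | _ => exact hg'.elim
  | abs f =>
    obtain ⟨e₁, M, he, h₁, -, -, t₁, t₂, hl, hs⟩ := hs
    obtain rfl := Multiset.singleton_inj.1 he
    cases g' with
    | gen l' =>
      obtain ⟨e₁, he, h₂, -⟩ := hs'
      obtain rfl := Multiset.singleton_inj.1 he
      simp [h₁] at h₂
    | abs f' =>
      obtain ⟨e₁, M', he, h₂, -, -, t₁', t₂', hl', hs'⟩ := hs'
      obtain rfl := Multiset.singleton_inj.1 he
      obtain rfl := hl.eq hl'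
      have hff := hs.toMor_eq hH hs' (fun e' he' => ih e' ((hl.2 e').1 he')) (hH.inputs_nodup _)
        hl.1 fun v hv e _ => inputs_disjoint_tgt hH hv e
      -- The congruence rule for abstractions needs equal types. The source labels give the context,
      -- and the label of the target gives the abstracted and the output types; the inner inputs
      -- alone would not show where to split them.
      obtain rfl := t₁.symm.trans t₁'
      have := t₂.symm.trans t₂'
      simp only [List.cons.injEq, Ty.lolly.injEq, and_true] at this
      obtain ⟨rfl, rfl⟩ := this
      exact toMor_eq_iff.2 (.abs_congr (toMor_eq_iff.1 hff))
    | _ => exact hg'.elim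
  | _ => exact hg.elim

theorem sat_of_isomorphic {S : Diagram Sg A C} (h : S.interp.Isomorphic H)
    {M : Multiset H.E} (hM : H.IsLevel none M) : S.Sat (H.inputs none) (H.outputs none) M := by
  obtain ⟨φ⟩ := h
  have := S.interp_spec.1.finite_E
  obtain ⟨M', hM'⟩ := exists_isLevel S.interp none
  have hs := φ.toHom.sat (S.sat_interp hM')
  have e₁ := φ.inputs_eq none
  have e₂ := φ.outputs_eq none
  have e₃ := hM.eq (hM'.map_equiv φ.onE φ.parE_eq)
  rw [e₃]
  simp only [Option.map_none] at e₁ e₂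
  rw [e₁, e₂]
  exact hs

theorem isomorphic_of_sat (hH : H.IsHypernet) {S : Diagram Sg A C} {M : Multiset H.E}
    (hM : H.IsLevel none M) (h : S.Sat (H.inputs none) (H.outputs none) M) :
    S.interp.Isomorphic H := by
  obtain ⟨φ, hi, ho, hφ⟩ := h.exists_hom hH
  exact φ.isomorphic S.interp_spec.1 hH hi.symm ho.symm fun M₀ h₀ => (hφ M₀ h₀).symm ▸ hM

/-- Diagrams with the same interpretation are equal modulo the axioms. -/
theorem smcEq_of_isomorphic (hH : H.IsHypernet) {S : Diagram Sg A C} {S' : Diagram Sg A' C'}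
    (h : S.interp.Isomorphic H) (h' : S'.interp.Isomorphic H) : SMCEq S S' := by
  have := hH.finite_E
  obtain ⟨M, hM⟩ := exists_isLevel H none
  exact toMor_eq_iff.1 ((sat_of_isomorphic h hM).toMor_eq hH (sat_of_isomorphic h' hM)
    (fun e _ => IsAtomic.toMor_eq hH e) (hH.inputs_nodup _) hM.1
    fun v hv e _ => inputs_disjoint_tgt hH hv e)

end Diagram

/-! ### Every well-typed hypernet has the shape of a diagram -/

namespace Net

/-- The part of a net with inputs `Γ`, outputs `out` and edges `M` has the shape of a diagram. -/
def HasShape (H : Net Sg) (Γ out : List H.V) (M : Multiset H.E) : Prop :=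
  ∃ (A C : Obj B) (S : Diagram Sg A C), S.Sat Γ out M

variable {H : Net Sg}

theorem HasShape.comp {Γ Θ out : List H.V} {M₁ M₂ : Multiset H.E} (h₁ : H.HasShape Γ Θ M₁)
    (h₂ : H.HasShape Θ out M₂) : H.HasShape Γ out (M₁ + M₂) := by
  obtain ⟨A, C, S, hS⟩ := h₁
  obtain ⟨A', C', S', hS'⟩ := h₂
  obtain rfl : C = A' := hS.types.2.symm.trans hS'.types.1
  exact ⟨_, _, S.comp S', _, _, _, hS, hS', rfl⟩

theorem HasShape.tensor {Γ₁ Γ₂ out₁ out₂ : List H.V} {M₁ M₂ : Multiset H.E}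
    (h₁ : H.HasShape Γ₁ out₁ M₁) (h₂ : H.HasShape Γ₂ out₂ M₂) :
    H.HasShape (Γ₁ ++ Γ₂) (out₁ ++ out₂) (M₁ + M₂) := by
  obtain ⟨A, C, S, hS⟩ := h₁
  obtain ⟨A', C', S', hS'⟩ := h₂
  exact ⟨_, _, S.tensor S', _, _, _, _, _, _, hS, hS', rfl, rfl, rfl⟩

theorem hasShape_id (Γ : List H.V) : H.HasShape Γ Γ 0 :=
  ⟨_, _, .id (Γ.map H.labV), rfl, rfl, rfl⟩

/-- A permutation is a composite of adjacent transpositions, each of which is a symmetry beside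
identities. -/
theorem hasShape_of_perm {Γ Γ' : List H.V} (h : Γ.Perm Γ') : H.HasShape Γ Γ' 0 := by
  induction h with
  | nil => exact hasShape_id []
  | cons x _ ih => exact (hasShape_id [x]).tensor ih
  | swap x y l =>
    exact HasShape.tensor (Γ₁ := [y, x]) (out₁ := [x, y]) (M₁ := 0) (M₂ := 0)
      ⟨_, _, .swap [H.labV y] [H.labV x], [y], [x], rfl, rfl, rfl, rfl, rfl⟩ (hasShape_id l)
  | trans _ _ ih ih' => exact ih.comp ih'

/-- A downward closed set of edges of a level can be performed first; here `R` is the set of the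
other edges. -/
theorem hasShape_of_remaining (hH : H.IsHypernet) {p : Option H.E}
    (hp : ∀ e, H.parE e = p → H.HasShape (H.src e) (H.tgt e) {e}) (R : Multiset H.E)
    (hR : R.Nodup) (hRp : ∀ e ∈ R, H.parE e = p) (hcl : ∀ e ∈ R, ∀ e', H.Precedes e e' → e' ∈ R)
    {Γ : List H.V} (hΓ : Γ.Nodup)
    -- `Γ` is the frontier between performed and remaining edges: the wires that no remaining edge
    -- still has to produce and no performed edge has consumed.
    (hmem : ∀ v, v ∈ Γ ↔ H.parV v = p ∧ (∀ e ∈ R, v ∉ H.tgt e) ∧ ∀ e ∉ R, v ∉ H.src e) :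
    H.HasShape Γ (H.outputs p) R := by
  classical
  have := hH.finite_E
  obtain ⟨r, hr⟩ := exists_rank hH.acyclic
  induction hn : R.card generalizing R Γ with
  | zero =>
    obtain rfl := Multiset.card_eq_zero.1 hn
    refine hasShape_of_perm ((List.perm_ext_iff_of_nodup hΓ (hH.outputs_nodup p)).2 fun v => ?_)
    rw [hmem, hH.mem_outputs]
    simp [IsOutput]
  | succ n ih =>
    -- An edge of least rank is preceded by no remaining edge, so its sources lie on the frontier.
    obtain ⟨e, heR, hmin⟩ : ∃ e ∈ R, ∀ e' ∈ R, r e ≤ r e' := by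
      obtain ⟨e, he, h⟩ := R.toFinset.exists_min_image r (by
        obtain ⟨e, he⟩ := Multiset.card_pos_iff_exists_mem.1 (by omega : 0 < R.card)
        exact ⟨e, by simpa using he⟩)
      exact ⟨e, by simpa using he, fun e' he' => h e' (by simpa using he')⟩
    have hmin' : ∀ e' ∈ R, ¬ H.Precedes e' e := fun e' he' h =>
      absurd (hr _ _ h) (not_lt.2 (hmin e' he'))
    obtain ⟨R', rfl⟩ := Multiset.exists_cons_of_mem heR
    rw [Multiset.nodup_cons] at hR
    have hsub : H.src e ⊆ Γ := by
      intro v hv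
      refine (hmem v).2 ⟨(hH.par_src e v hv).trans (hRp e heR), fun e' he' hv' => ?_,
        fun e' he' hv' => ?_⟩
      · exact hmin' e' he' ⟨v, hv', hv⟩
      · exact he' (hH.src_unique _ _ _ hv hv' ▸ heR)
    obtain ⟨Δ, hΔ⟩ : ∃ Δ, Γ.Perm (H.src e ++ Δ) :=
      ⟨_, (List.subperm_append_diff_self_of_count_le fun x _ =>
        (List.subperm_of_subset (hH.src_nodup e) hsub).count_le x).symm⟩
    have hn' := List.nodup_append.1 (hΔ.nodup_iff.1 hΓ)
    have hΔΓ : ∀ v, v ∈ Δ → v ∈ Γ := fun v hv => hΔ.symm.subset (List.mem_append_right _ hv)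
    -- Performing `e` replaces its sources on the frontier by its targets; `R'` stays closed under
    -- successors because nothing remaining precedes `e`.
    have key : H.HasShape (H.tgt e ++ Δ) (H.outputs p) R' := by
      refine ih R' hR.2 (fun e' he' => hRp e' (Multiset.mem_cons_of_mem he'))
        (fun a ha e' hae => ?_) ?_ (fun v => ⟨fun hv => ?_, fun hv => ?_⟩) (by simpa using hn)
      · refine (Multiset.mem_cons.1 (hcl a (Multiset.mem_cons_of_mem ha) e' hae)).resolve_left ?_
        rintro rfl
        exact hmin' a (Multiset.mem_cons_of_mem ha) hae
      · refine List.nodup_append.2 ⟨hH.tgt_nodup e, hn'.2.1, ?_⟩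
        rintro v hv _ hv' rfl
        exact ((hmem v).1 (hΔΓ v hv')).2.1 e heR hv
      · rcases List.mem_append.1 hv with hv | hvΔ
        · refine ⟨(hH.par_tgt e v hv).trans (hRp e heR), fun e' he' hv' => ?_, fun e' he' hv' => ?_⟩
          · exact hR.1 (hH.tgt_unique _ _ _ hv hv' ▸ he')
          · have h := hcl e heR e' ⟨v, hv, hv'⟩
            rcases Multiset.mem_cons.1 h with rfl | h
            · exact hmin' _ heR ⟨v, hv, hv'⟩
            · exact he' h
        · obtain ⟨h1, h2, h3⟩ := (hmem v).1 (hΔΓ v hvΔ)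
          refine ⟨h1, fun e' he' => h2 e' (Multiset.mem_cons_of_mem he'), fun e' he' hv' => ?_⟩
          by_cases h : e' = e
          · subst h
            exact hn'.2.2 v hv' v hvΔ rfl
          · exact h3 e' (by simp [h, he']) hv'
      · obtain ⟨h1, h2, h3⟩ := hv
        by_cases hve : v ∈ H.tgt e
        · exact List.mem_append_left _ hve
        · have hvΓ : v ∈ Γ := by
            refine (hmem v).2 ⟨h1, fun e' he' => ?_, fun e' he' => h3 e' fun h =>
              he' (Multiset.mem_cons_of_mem h)⟩
            rcases Multiset.mem_cons.1 he' with rfl | he'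
            · exact hve
            · exact h2 e' he'
          exact List.mem_append_right _
            ((List.mem_append.1 (hΔ.subset hvΓ)).resolve_left (h3 e hR.1))
    simpa using (hasShape_of_perm hΔ).comp (((hp e (hRp e heR)).tensor (hasShape_id Δ)).comp key)

/-- At the start all edges of the level remain, and the frontier consists of its inputs. Closure
holds because an edge shares its level with its sources and targets. -/
theorem hasShape_level (hH : H.IsHypernet) {p : Option H.E}
    (hp : ∀ e, H.parE e = p → H.HasShape (H.src e) (H.tgt e) {e}) {M : Multiset H.E}
    (hM : H.IsLevel p M) : H.HasShape (H.inputs p) (H.outputs p) M := by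
  refine hasShape_of_remaining hH hp M hM.1 (fun e he => (hM.2 e).1 he) ?_ (hH.inputs_nodup p) ?_
  · rintro e he e' ⟨v, hv, hv'⟩
    rw [hM.2] at he ⊢
    rw [← hH.par_src e' v hv', hH.par_tgt e v hv, he]
  · intro v
    rw [hH.mem_inputs]
    refine ⟨fun ⟨h1, h2⟩ => ⟨h1, fun e _ => h2 e, fun e he hv => he ?_⟩, fun ⟨h1, h2, _⟩ =>
      ⟨h1, fun e hv => h2 e ((hM.2 e).2 ?_) hv⟩⟩
    · rw [hM.2, ← hH.par_src e v hv, h1]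
    · rw [← hH.par_tgt e v hv, h1]

/-- Induction from the inside: the inner level of an unlabelled edge has the shape of some diagram,
and well-typedness says that its interface types fit the abstraction rule with context `H.src e` and
abstracted types `La`. -/
theorem hasShape_edge (hH : H.IsHypernet) (hW : H.WellTyped) (e : H.E) :
    H.HasShape (H.src e) (H.tgt e) {e} := by
  have := hH.finite_E
  induction e using hH.edge_induction with
  | _ e ih =>
  cases he : H.labE e with
  | some l =>
    obtain ⟨h1, h2⟩ := hW.labelled e l he
    exact ⟨_, _, .gen l, e, rfl, he, rfl, rfl, h1, h2⟩
  | none =>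
    obtain ⟨La, h1, h2⟩ := hW.unlabelled e he
    obtain ⟨M, hM⟩ := exists_isLevel H (some e)
    obtain ⟨A, C, S, hS⟩ := hasShape_level hH ih hM
    obtain ⟨t1, t2⟩ := hS.types
    rw [t2] at h2
    exact ⟨_, _, (S.cast (t1.symm.trans h1.symm) rfl).abs, e, M, rfl, he, rfl, rfl, rfl, h2, hM,
      (Diagram.sat_cast ..).2 hS⟩

end Net

end HSD

/-! ### The theorem -/

theorem theorem3 {B : Type u} (Sg : HSD.Signature.{u, v} B) :
    -- every well-typed hypernet is the interpretation of a string diagram, unique modulo SMC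
    (∀ H : HSD.Net Sg, H.IsHypernet → H.WellTyped →
      ∃ S : HSD.Diagram Sg H.inTypes H.outTypes,
        S.interp.Isomorphic H ∧
          ∀ (A' C' : HSD.Obj B) (S' : HSD.Diagram Sg A' C'),
            S'.interp.Isomorphic H → HSD.SMCEq S S') ∧
    -- every string diagram is interpreted by a well-typed hypernet with the same interface types
    (∀ (A C : HSD.Obj B) (S : HSD.Diagram Sg A C),
      S.interp.IsHypernet ∧ S.interp.WellTyped ∧
        S.interp.inTypes = A ∧ S.interp.outTypes = C) ∧
    -- soundness and completeness
    (∀ (A C A' C' : HSD.Obj B) (S : HSD.Diagram Sg A C) (S' : HSD.Diagram Sg A' C'),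
      HSD.SMCEq S S' ↔ S.interp.Isomorphic S'.interp) := by
  refine ⟨fun H hH hW => ?_, fun A C S => S.interp_spec, fun A C A' C' S S' => ⟨fun h => ?_,
    fun h => ?_⟩⟩
  · have := hH.finite_E
    obtain ⟨M, hM⟩ := HSD.Net.exists_isLevel H none
    obtain ⟨A, C, S, hS⟩ :=
      HSD.Net.hasShape_level hH (fun e _ => HSD.Net.hasShape_edge hH hW e) hM
    obtain ⟨rfl, rfl⟩ := hS.types
    have hi := HSD.Diagram.isomorphic_of_sat hH hM hS
    exact ⟨S, hi, fun A' C' S' h' => HSD.Diagram.smcEq_of_isomorphic hH hi h'⟩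
  · have hS' := S'.interp_spec.1
    have := hS'.finite_E
    obtain ⟨M, hM⟩ := HSD.Net.exists_isLevel S'.interp none
    -- `S'` has the shape of its own interpretation, hence so does the equal diagram `S`, and a
    -- diagram with the shape of a hypernet is interpreted by it.
    exact HSD.Diagram.isomorphic_of_sat hS' hM ((h.sat_iff _ _ _).2 (S'.sat_interp hM))
  · refine HSD.Diagram.smcEq_of_isomorphic S'.interp_spec.1 h ⟨?_⟩
    exact { onV := Equiv.refl _
            onE := Equiv.refl _
            src_eq := by simp
            tgt_eq := by simp
            labV_eq := by simp
            labE_eq := by simp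
            parV_eq := by simp
            parE_eq := by simp
            inputs_eq := by simp
            outputs_eq := by simp }
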